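/- Let $\lambda$ be an ordinal; "ordinal" below means an ordinal $\nu<\lambda$. *Types.* $0$ is the type of order $0$; for $\nu>0$, $n\ge 1$ and types $\tau_1,\dots,\tau_n$ of orders $<\nu$, $\nu(\tau_1\cdots\tau_n)$ is a type of order $\nu$. For each type there are countably many free variables $p^\tau,q^\tau,\dots$ and bound variables $x^\tau,y^\tau,\dots$; formulas are taken up to renaming of bound variables. *Formulas.* Let $\nu>0$. The *deductive formulas of order $\nu$* are built from $0$ (false), $1$ (true) and the prime formulas $(p^\tau p_1^{\tau_1}\cdots p_n^{\tau_n})$, $\tau=\mu(\tau_1\cdots\tau_n)$, $\mu\le\nu$, by $\land,\lor,\neg$ and by quantification $\forall_{x^\tau}c(x^\tau)$, $\exists_{x^\tau}c(x^\tau)$ over types $\tau$ of order $<\nu$. A formula is *proper* if it contains neither $0$ nor $1$. The *inductive formulas* and the *constants* are defined simultaneously: the constants of type $0$ are the numerals $1,1+1,\dots$; for a type $\tau=\nu(\tau_1\cdots\tau_n)$ and an inductive formula $c(p_1^{\tau_1},\dots,p_n^{\tau_n})$ of order $\nu$ in which no variable and no constant of a type of order $\nu$ occurs, $(x_1^{\tau_1}\cdots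 x_n^{\tau_n})^\nu c(x_1^{\tau_1},\dots,x_n^{\tau_n})$ is a constant of type $\tau$; inductive formulas are formed like proper formulas, except that $(p^0>q^0)$ is also a prime formula and that in prime formulas constants may be put for free variables of the same type. $a\supset b$ is $\neg a\lor b$, and $a\leftrightarrow b$ is $(a\supset b)\land(b\supset a)$. *Deductive calculus.* Theorems are pairs $a\Rightarrow b$ of deductive formulas. Axioms: $c\Rightarrow c$, $0\Rightarrow c$, $c\Rightarrow 1$; comprehension $1\Rightarrow\exists_{x^\tau}\forall_{x_1^{\tau_1}}\cdots\forall_{x_n^{\tau_n}}(x^\tau x_1\cdots x_n\leftrightarrow c(x_1,\dots,x_n))$ for $\tau=\nu(\tau_1\cdots\tau_n)$ and $c$ of order $\nu$, whenever this is a formula; extensionality $\forall_{x_1}\cdots\forall_{x_n}(p^\tau x_1\cdots x_n\leftrightarrow q^\tau x_1\cdots x_n)\Rightarrow c(p^\tau)\supset c(q^\tau)$; and infinity, whenever it is a formula, for $\tau=1(00)$: $1\Rightarrow\exists_{x^\tau}(\forall_{x^0}\neg x^\tau x^0x^0\land\forall_{x^0}\exists_{y^0}x^\tau x^0y^0\land\forall_{x^0}\forall_{y^0}\forall_{z^0}((x^\tau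 x^0y^0\land x^\tau y^0z^0)\supset x^\tau x^0z^0))$. (There is no axiom of reducibility.) Rules: - from $a\Rightarrow c$ and $c\Rightarrow b$ infer $a\Rightarrow b$; - from $a\Rightarrow b$ infer $a\land c\Rightarrow b$, $c\land a\Rightarrow b$, $a\Rightarrow b\lor c$, $a\Rightarrow c\lor b$; - from $a\Rightarrow b_1$ and $a\Rightarrow b_2$ infer $a\Rightarrow b_1\land b_2$; from $a_1\Rightarrow b$ and $a_2\Rightarrow b$ infer $a_1\lor a_2\Rightarrow b$; - from $a\land c\Rightarrow b$ infer $a\Rightarrow b\lor\neg c$; from $a\Rightarrow b\lor c$ infer $a\land\neg c\Rightarrow b$; - from $a\Rightarrow\forall_{x}c(x)$ infer $a\Rightarrow c(p)$, and from $\exists_xc(x)\Rightarrow b$ infer $c(p)\Rightarrow b$; if $p$ does not occur in $a$, $b$, $c(x)$, conversely from $a\Rightarrow c(p)$ infer $a\Rightarrow\forall_xc(x)$, and from $c(p)\Rightarrow b$ infer $\exists_xc(x)\Rightarrow b$. The *proper deductive calculus* is the same calculus for proper formulas, where a left side $1$ and a right side $0$ are expressed by omitting that side (in the rules $a$ and $b$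 may be omitted, $a\land c$, $b\lor c$ then being read as $c$), and without the axioms $0\Rightarrow c$ and $c\Rightarrow1$. *Inductive calculus.* Theorems are pairs $a\Rightarrow b$ of inductive formulas, where either side may be omitted; in the rules the side formulas ($a$, $b$ and, in the two-premise rules, $c$) may be omitted. Axioms: for numerals $k,l$, $\Rightarrow(k>l)$ if it is true and $(k>l)\Rightarrow$ if it is false. Rules: - association, transposition and contraction of the terms of a conjunction on the left or of a disjunction on the right; - from $a\Rightarrow b$ infer $a\Rightarrow b\lor c$ and $a\land c\Rightarrow b$; - from $a\Rightarrow b_1\lor c$ and $a\Rightarrow b_2\lor c$ infer $a\Rightarrow(b_1\land b_2)\lor c$; from $a_1\land c\Rightarrow b$ and $a_2\land c\Rightarrow b$ infer $(a_1\lor a_2)\land c\Rightarrow b$; - from $a\land c\Rightarrow b$ infer $a\Rightarrow b\lor\neg c$; from $a\Rightarrow b\lor c$ infer $a\land\neg c\Rightarrow b$; - if $p$ does not occur in $a$, $b$, $c(x)$: from $a\Rightarrow b\lor c(p)$ infer $a\Rightarrow b\lor\forall_xc(x)$, and from $a\land c(p)\Rightarrow b$ infer $a\land\exists_xc(x)\Rightarrow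 b$; for a constant $t$: from $a\land c(t)\Rightarrow b$ infer $a\land\forall_xc(x)\Rightarrow b$, and from $a\Rightarrow b\lor c(t)$ infer $a\Rightarrow b\lor\exists_xc(x)$; - induction rule: a pair $C(p^\tau)$ is a theorem if $C(t)$ is a theorem for every constant $t$ of type $\tau$; - rule of constants: for a constant $t=(x_1\cdots x_n)^\nu a(x_1,\dots,x_n)$, $C$ is a theorem if $C/t$ is, where $C/t$ arises from $C$ by replacing each prime formula $t\,c_1\cdots c_n$ beginning with $t$ by $a(c_1,\dots,c_n)$. **Theorem.** Every theorem of the proper deductive calculus is a theorem of the inductive calculus. The cut rule is admissible in the inductive calculus: if $a\Rightarrow c$ and $c\Rightarrow b$ are inductive theorems, where $c$ is a formula and $a$, $b$ are formulas or omitted, then so is $a\Rightarrow b$. The empty sequent $\Rightarrow$ is a theorem neither of the inductive nor of the proper deductive calculus, and $1\Rightarrow0$ is not a theorem of the deductive calculus; that is, ramified type logic including arithmetic is consistent. -/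

import Mathlib

/-!
Ramified type logic over an ordinal `lam`: types, terms, formulas, the deductive calculus, the proper
deductive calculus and the inductive calculus.  Formulas are taken up to renaming of bound variables:
free variables are named, bound variables are de Bruijn indices.
-/

universe u

namespace Ramified

/-- Raw types: `0`, and `ν (τ₁ … τₙ)`.  The condition on the orders is `Ty.WF`. -/
inductive Ty : Type (u + 1)
  | ind : Ty
  | rel (ν : Ordinal.{u}) (n : ℕ) (args : Fin n → Ty) : Ty

namespace Ty

/-- The order of a type. -/
def order : Ty.{u} → Ordinal.{u}
  | ind => 0
  | rel ν _ _ => ν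

/-- `τ` is a type, all ordinals occurring in it being `< lam`: `ν (τ₁ … τₙ)` requires `n ≥ 1` and that
every `τᵢ` is a type of order `< ν`. -/
def WF (lam : Ordinal.{u}) : Ty.{u} → Prop
  | ind => 0 < lam
  | rel ν n args => ν < lam ∧ 0 < n ∧ ∀ j : Fin n, (args j).WF lam ∧ (args j).order < ν

end Ty

mutual

/-- Raw terms.  `fvar τ i` is the free variable `(τ)ᵢ`; `bvar k` is the variable bound by the `k`-th
enclosing binder; `num k` is the constant `1 + 1 + ⋯ + 1` of type `0` with `k` signs `+`;
`cst ν n τs c` is `(x₁ … xₙ)^ν c(x₁, …, xₙ)` with `x₁, …, xₙ` of types `τs`.  It binds `n` variables,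
the last one, `xₙ`, having index `0`. -/
inductive Tm : Type (u + 1)
  | fvar (τ : Ty.{u}) (i : ℕ) : Tm
  | bvar (k : ℕ) : Tm
  | num (k : ℕ) : Tm
  | cst (ν : Ordinal.{u}) (n : ℕ) (τs : Fin n → Ty.{u}) (body : Fm) : Tm

/-- Raw formulas: `bot` and `top` are the signs `0` and `1`; `gt s t` is `(s > t)`; `app f n ts` is
`(f t₁ … tₙ)`; `all τ c` and `ex τ c` bind the index `0` in `c`. -/
inductive Fm : Type (u + 1)
  | bot : Fm
  | top : Fm
  | gt (s t : Tm) : Fm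
  | app (f : Tm) (n : ℕ) (ts : Fin n → Tm) : Fm
  | and (a b : Fm) : Fm
  | or (a b : Fm) : Fm
  | neg (a : Fm) : Fm
  | all (τ : Ty.{u}) (c : Fm) : Fm
  | ex (τ : Ty.{u}) (c : Fm) : Fm

end

/-! ### Renaming and substitution -/

/-- A renaming of indices, pushed under `n` binders. -/
def upRen (n : ℕ) (ρ : ℕ → ℕ) (k : ℕ) : ℕ := if k < n then k else ρ (k - n) + n

mutual

def Tm.rename (ρ : ℕ → ℕ) : Tm.{u} → Tm.{u}
  | .fvar τ i => .fvar τ i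
  | .bvar k => .bvar (ρ k)
  | .num k => .num k
  | .cst ν n τs c => .cst ν n τs (c.rename (upRen n ρ))

def Fm.rename (ρ : ℕ → ℕ) : Fm.{u} → Fm.{u}
  | .bot => .bot
  | .top => .top
  | .gt s t => .gt (s.rename ρ) (t.rename ρ)
  | .app f n ts => .app (f.rename ρ) n (fun j => (ts j).rename ρ)
  | .and a b => .and (a.rename ρ) (b.rename ρ)
  | .or a b => .or (a.rename ρ) (b.rename ρ)
  | .neg a => .neg (a.rename ρ)
  | .all τ c => .all τ (c.rename (upRen 1 ρ))
  | .ex τ c => .ex τ (c.rename (upRen 1 ρ))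

end

/-- A substitution for the free variables, pushed under `n` binders. -/
def upFree (n : ℕ) (θ : Ty.{u} → ℕ → Tm.{u}) (τ : Ty.{u}) (i : ℕ) : Tm.{u} :=
  (θ τ i).rename (fun k => k + n)

/-- A substitution for the indices, pushed under `n` binders. -/
def upBound (n : ℕ) (σ : ℕ → Tm.{u}) (k : ℕ) : Tm.{u} :=
  if k < n then .bvar k else (σ (k - n)).rename (fun k => k + n)

/-! Simultaneous capture-avoiding substitution of `θ` for the free variables and of `σ` for the
indices. -/

mutual

def Tm.subst (θ : Ty.{u} → ℕ → Tm.{u}) (σ : ℕ → Tm.{u}) : Tm.{u} → Tm.{u}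
  | .fvar τ i => θ τ i
  | .bvar k => σ k
  | .num k => .num k
  | .cst ν n τs c => .cst ν n τs (c.subst (upFree n θ) (upBound n σ))

def Fm.subst (θ : Ty.{u} → ℕ → Tm.{u}) (σ : ℕ → Tm.{u}) : Fm.{u} → Fm.{u}
  | .bot => .bot
  | .top => .top
  | .gt s t => .gt (s.subst θ σ) (t.subst θ σ)
  | .app f n ts => .app (f.subst θ σ) n (fun j => (ts j).subst θ σ)
  | .and a b => .and (a.subst θ σ) (b.subst θ σ)
  | .or a b => .or (a.subst θ σ) (b.subst θ σ)
  | .neg a => .neg (a.subst θ σ)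
  | .all τ c => .all τ (c.subst (upFree 1 θ) (upBound 1 σ))
  | .ex τ c => .ex τ (c.subst (upFree 1 θ) (upBound 1 σ))

end

/-- `c(t₁, …, tₙ)`, where `c` has been written with the indices of `n` binders for its arguments (the
last argument having index `0`). -/
def Fm.inst (c : Fm.{u}) (n : ℕ) (ts : Fin n → Tm.{u}) : Fm.{u} :=
  c.subst Tm.fvar (fun k => if h : k < n then ts (Fin.rev ⟨k, h⟩) else .bvar (k - n))

/-- `c(t)`, where `c` is the body of `all τ c` or `ex τ c`. -/
def Fm.inst1 (c : Fm.{u}) (t : Tm.{u}) : Fm.{u} := c.inst 1 (fun _ => t)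

open Classical in
/-- Substitution of `t` for every occurrence of the free variable `(τ)ᵢ`. -/
noncomputable def Fm.replace (τ : Ty.{u}) (i : ℕ) (t : Tm.{u}) (c : Fm.{u}) : Fm.{u} :=
  c.subst (fun σ j => if σ = τ ∧ j = i then t else .fvar σ j) Tm.bvar

/-! The free variable `(τ)ᵢ` occurs in a term or formula. -/

mutual

def Tm.Occurs (τ : Ty.{u}) (i : ℕ) : Tm.{u} → Prop
  | .fvar σ j => σ = τ ∧ j = i
  | .bvar _ => False
  | .num _ => False
  | .cst _ _ _ c => c.Occurs τ i

def Fm.Occurs (τ : Ty.{u}) (i : ℕ) : Fm.{u} → Prop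
  | .bot => False
  | .top => False
  | .gt s t => s.Occurs τ i ∨ t.Occurs τ i
  | .app f _ ts => f.Occurs τ i ∨ ∃ j, (ts j).Occurs τ i
  | .and a b => a.Occurs τ i ∨ b.Occurs τ i
  | .or a b => a.Occurs τ i ∨ b.Occurs τ i
  | .neg a => a.Occurs τ i
  | .all _ c => c.Occurs τ i
  | .ex _ c => c.Occurs τ i

end

/-! ### Formulas and constants -/

/-- The types of the variables of `n` nested binders, innermost (last) variable first. -/
def ctx {n : ℕ} (τs : Fin n → Ty.{u}) : List Ty.{u} := List.ofFn (fun j => τs j.rev)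

/-! No variable and no constant of a type of order `ν` occurs; `Γ` lists the types of the indices. -/

mutual

def Tm.Avoids (ν : Ordinal.{u}) : List Ty.{u} → Tm.{u} → Prop
  | _, .fvar τ _ => τ.order ≠ ν
  | Γ, .bvar k => ∀ τ, Γ[k]? = some τ → τ.order ≠ ν
  | _, .num _ => (Ty.ind : Ty.{u}).order ≠ ν
  | Γ, .cst μ _ τs c => μ ≠ ν ∧ c.Avoids ν (ctx τs ++ Γ)

def Fm.Avoids (ν : Ordinal.{u}) : List Ty.{u} → Fm.{u} → Prop
  | _, .bot => True
  | _, .top => True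
  | Γ, .gt s t => s.Avoids ν Γ ∧ t.Avoids ν Γ
  | Γ, .app f _ ts => f.Avoids ν Γ ∧ ∀ j, (ts j).Avoids ν Γ
  | Γ, .and a b => a.Avoids ν Γ ∧ b.Avoids ν Γ
  | Γ, .or a b => a.Avoids ν Γ ∧ b.Avoids ν Γ
  | Γ, .neg a => a.Avoids ν Γ
  | Γ, .all τ c => τ.order ≠ ν ∧ c.Avoids ν (τ :: Γ)
  | Γ, .ex τ c => τ.order ≠ ν ∧ c.Avoids ν (τ :: Γ)

end

/-- The three languages: deductive (with `0` and `1`), proper deductive (without), inductive (without,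
but with `>` and constants). -/
inductive Calc
  | ded
  | proper
  | ind

mutual

/-- `IsTm lam K Γ t τ`: `t` is a variable or constant of type `τ` of the language `K`, where `Γ` lists
the types of the indices. -/
inductive IsTm (lam : Ordinal.{u}) (K : Calc) : List Ty.{u} → Tm.{u} → Ty.{u} → Prop
  | fvar {Γ : List Ty.{u}} {τ : Ty.{u}} {i : ℕ} (hτ : τ.WF lam) : IsTm lam K Γ (.fvar τ i) τ
  | bvar {Γ : List Ty.{u}} {τ : Ty.{u}} {k : ℕ} (h : Γ[k]? = some τ) : IsTm lam K Γ (.bvar k) τ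
  | num {Γ : List Ty.{u}} {k : ℕ} (hK : K = .ind) : IsTm lam K Γ (.num k) .ind
  | cst {Γ : List Ty.{u}} {ν : Ordinal.{u}} {n : ℕ} {τs : Fin n → Ty.{u}} {c : Fm.{u}}
      (hK : K = .ind) (hτ : (Ty.rel ν n τs).WF lam) (hc : IsFm lam K ν (ctx τs ++ Γ) c)
      (hν : c.Avoids ν (ctx τs ++ Γ)) : IsTm lam K Γ (.cst ν n τs c) (.rel ν n τs)

/-- `IsFm lam K ν Γ c`: `c` is a formula of `ν`-th order of the language `K`, where `Γ` lists the types
of the indices. -/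
inductive IsFm (lam : Ordinal.{u}) (K : Calc) : Ordinal.{u} → List Ty.{u} → Fm.{u} → Prop
  | bot {ν : Ordinal.{u}} {Γ : List Ty.{u}} (hK : K = .ded) : IsFm lam K ν Γ .bot
  | top {ν : Ordinal.{u}} {Γ : List Ty.{u}} (hK : K = .ded) : IsFm lam K ν Γ .top
  | gt {ν : Ordinal.{u}} {Γ : List Ty.{u}} {s t : Tm.{u}} (hK : K = .ind)
      (hs : IsTm lam K Γ s .ind) (ht : IsTm lam K Γ t .ind) : IsFm lam K ν Γ (.gt s t)
  | app {ν μ : Ordinal.{u}} {Γ : List Ty.{u}} {f : Tm.{u}} {n : ℕ} {τs : Fin n → Ty.{u}}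
      {ts : Fin n → Tm.{u}} (hμ : μ ≤ ν) (hf : IsTm lam K Γ f (.rel μ n τs))
      (hts : ∀ j, IsTm lam K Γ (ts j) (τs j)) : IsFm lam K ν Γ (.app f n ts)
  | and {ν : Ordinal.{u}} {Γ : List Ty.{u}} {a b : Fm.{u}}
      (ha : IsFm lam K ν Γ a) (hb : IsFm lam K ν Γ b) : IsFm lam K ν Γ (.and a b)
  | or {ν : Ordinal.{u}} {Γ : List Ty.{u}} {a b : Fm.{u}}
      (ha : IsFm lam K ν Γ a) (hb : IsFm lam K ν Γ b) : IsFm lam K ν Γ (.or a b)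
  | neg {ν : Ordinal.{u}} {Γ : List Ty.{u}} {a : Fm.{u}}
      (ha : IsFm lam K ν Γ a) : IsFm lam K ν Γ (.neg a)
  | all {ν : Ordinal.{u}} {Γ : List Ty.{u}} {τ : Ty.{u}} {c : Fm.{u}} (hτ : τ.WF lam)
      (hν : τ.order < ν) (hc : IsFm lam K ν (τ :: Γ) c) : IsFm lam K ν Γ (.all τ c)
  | ex {ν : Ordinal.{u}} {Γ : List Ty.{u}} {τ : Ty.{u}} {c : Fm.{u}} (hτ : τ.WF lam)
      (hν : τ.order < ν) (hc : IsFm lam K ν (τ :: Γ) c) : IsFm lam K ν Γ (.ex τ c)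

end

/-- `c` is a formula of some order `ν` with `0 < ν < lam`, with indices of the types `Γ`. -/
def IsFormulaIn (lam : Ordinal.{u}) (K : Calc) (Γ : List Ty.{u}) (c : Fm.{u}) : Prop :=
  ∃ ν, 0 < ν ∧ ν < lam ∧ IsFm lam K ν Γ c

/-- `c` is a formula of the language `K`. -/
def IsFormula (lam : Ordinal.{u}) (K : Calc) (c : Fm.{u}) : Prop := IsFormulaIn lam K [] c

/-- `a` is a constant of type `τ` (a variable is excluded by the second condition). -/
def IsConst (lam : Ordinal.{u}) (a : Tm.{u}) (τ : Ty.{u}) : Prop :=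
  IsTm lam .ind [] a τ ∧ ∀ σ i, a ≠ .fvar σ i

/-! ### Abbreviations -/

/-- `a ⊃ b`, i.e. `¬a ∨ b`. -/
def Fm.imp (a b : Fm.{u}) : Fm.{u} := .or (.neg a) b

/-- `(¬a ∨ b) ∧ (¬b ∨ a)`. -/
def Fm.iff (a b : Fm.{u}) : Fm.{u} := .and (a.imp b) (b.imp a)

/-- `∀ x₁ … ∀ xₙ, c`. -/
def alls : (n : ℕ) → (Fin n → Ty.{u}) → Fm.{u} → Fm.{u}
  | 0, _, c => c
  | n + 1, τs, c => .all (τs 0) (alls n (fun j => τs j.succ) c)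

/-- `f x₁ … xₙ` for the variables `x₁, …, xₙ` of the `n` innermost binders. -/
def appVars (f : Tm.{u}) (n : ℕ) : Fm.{u} := .app f n (fun j => .bvar j.rev)

/-- `∃ x, ∀ x₁ … ∀ xₙ, (x x₁ … xₙ ↔ c(x₁, …, xₙ))` with `x` of type `ν (τ₁ … τₙ)`. -/
def comprehension (ν : Ordinal.{u}) (n : ℕ) (τs : Fin n → Ty.{u}) (c : Fm.{u}) : Fm.{u} :=
  .ex (.rel ν n τs) (alls n τs ((appVars (.bvar n) n).iff c))

/-- `∀ x₁ … ∀ xₙ, (p x₁ … xₙ ↔ q x₁ … xₙ)`. -/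
def coext (n : ℕ) (τs : Fin n → Ty.{u}) (p q : Tm.{u}) : Fm.{u} :=
  alls n τs ((appVars p n).iff (appVars q n))

/-- `f s t`. -/
def app2 (f s t : Tm.{u}) : Fm.{u} := .app f 2 ![s, t]

/-- `∃ x, (∀ u, ¬ x u u) ∧ (∀ u, ∃ v, x u v) ∧ ∀ u v w, ((x u v ∧ x v w) ⊃ x u w)`, where `x` has type
`1 (0 0)` and `u, v, w` have type `0`. -/
noncomputable def infinity : Fm.{u} :=
  .ex (.rel 1 2 (fun _ => .ind))
    (.and
      (.and (.all .ind (.neg (app2 (.bvar 1) (.bvar 0) (.bvar 0))))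
        (.all .ind (.ex .ind (app2 (.bvar 2) (.bvar 1) (.bvar 0)))))
      (.all .ind (.all .ind (.all .ind
        (((app2 (.bvar 3) (.bvar 2) (.bvar 1)).and (app2 (.bvar 3) (.bvar 1) (.bvar 0))).imp
          (app2 (.bvar 3) (.bvar 2) (.bvar 0)))))))

/-! ### The deductive calculus -/

/-- `DedThm lam a b`: the formula pair `a ⟹ b` is a theorem of the deductive calculus. -/
inductive DedThm (lam : Ordinal.{u}) : Fm.{u} → Fm.{u} → Prop
  | refl {c : Fm.{u}} (hc : IsFormula lam .ded c) : DedThm lam c c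
  | bot_le {c : Fm.{u}} (hc : IsFormula lam .ded c) : DedThm lam .bot c
  | le_top {c : Fm.{u}} (hc : IsFormula lam .ded c) : DedThm lam c .top
  | comp {ν : Ordinal.{u}} {n : ℕ} {τs : Fin n → Ty.{u}} {c : Fm.{u}}
      (hc : IsFm lam .ded ν (ctx τs) c) (h : IsFormula lam .ded (comprehension ν n τs c)) :
      DedThm lam .top (comprehension ν n τs c)
  | ext {ν : Ordinal.{u}} {n : ℕ} {τs : Fin n → Ty.{u}} {c : Fm.{u}} {i j : ℕ}
      (hτ : (Ty.rel ν n τs).WF lam) (hc : IsFormulaIn lam .ded [.rel ν n τs] c) :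
      DedThm lam (coext n τs (.fvar (.rel ν n τs) i) (.fvar (.rel ν n τs) j))
        ((c.inst1 (.fvar (.rel ν n τs) i)).imp (c.inst1 (.fvar (.rel ν n τs) j)))
  | inf (h : IsFormula.{u} lam .ded infinity) : DedThm lam .top infinity
  | cut {a b c : Fm.{u}} (h₁ : DedThm lam a c) (h₂ : DedThm lam c b) : DedThm lam a b
  | and_left₁ {a b c : Fm.{u}} (hc : IsFormula lam .ded c) (h : DedThm lam a b) :
      DedThm lam (.and a c) b
  | and_left₂ {a b c : Fm.{u}} (hc : IsFormula lam .ded c) (h : DedThm lam a b) :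
      DedThm lam (.and c a) b
  | or_right₁ {a b c : Fm.{u}} (hc : IsFormula lam .ded c) (h : DedThm lam a b) :
      DedThm lam a (.or b c)
  | or_right₂ {a b c : Fm.{u}} (hc : IsFormula lam .ded c) (h : DedThm lam a b) :
      DedThm lam a (.or c b)
  | and_right {a b₁ b₂ : Fm.{u}} (h₁ : DedThm lam a b₁) (h₂ : DedThm lam a b₂) :
      DedThm lam a (.and b₁ b₂)
  | or_left {a₁ a₂ b : Fm.{u}} (h₁ : DedThm lam a₁ b) (h₂ : DedThm lam a₂ b) :
      DedThm lam (.or a₁ a₂) b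
  | neg_right {a b c : Fm.{u}} (h : DedThm lam (.and a c) b) : DedThm lam a (.or b (.neg c))
  | neg_left {a b c : Fm.{u}} (h : DedThm lam a (.or b c)) : DedThm lam (.and a (.neg c)) b
  | all_spec {a c : Fm.{u}} {τ : Ty.{u}} {i : ℕ} (h : DedThm lam a (.all τ c)) :
      DedThm lam a (c.inst1 (.fvar τ i))
  | ex_spec {b c : Fm.{u}} {τ : Ty.{u}} {i : ℕ} (h : DedThm lam (.ex τ c) b) :
      DedThm lam (c.inst1 (.fvar τ i)) b
  | all_right {a c : Fm.{u}} {τ : Ty.{u}} {i : ℕ} (hc : IsFormula lam .ded (.all τ c))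
      (ha : ¬ a.Occurs τ i) (hi : ¬ c.Occurs τ i) (h : DedThm lam a (c.inst1 (.fvar τ i))) :
      DedThm lam a (.all τ c)
  | ex_left {b c : Fm.{u}} {τ : Ty.{u}} {i : ℕ} (hc : IsFormula lam .ded (.ex τ c))
      (hb : ¬ b.Occurs τ i) (hi : ¬ c.Occurs τ i) (h : DedThm lam (c.inst1 (.fvar τ i)) b) :
      DedThm lam (.ex τ c) b

/-! ### Formula pairs with an omitted side

In the proper deductive calculus and in the inductive calculus each side of `a ⟹ b` may be omitted;
an omitted side is `none`.  A conjunction or disjunction with an omitted formula `a` and a formula `c`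
is `c`. -/

/-- `a ∧ c`, with `a` possibly omitted. -/
def andL : Option Fm.{u} → Fm.{u} → Fm.{u}
  | none, c => c
  | some a, c => .and a c

/-- `c ∧ a`, with `a` possibly omitted. -/
def andR : Fm.{u} → Option Fm.{u} → Fm.{u}
  | c, none => c
  | c, some a => .and c a

/-- `b ∨ c`, with `b` possibly omitted. -/
def orL : Option Fm.{u} → Fm.{u} → Fm.{u}
  | none, c => c
  | some b, c => .or b c

/-- `c ∨ b`, with `b` possibly omitted. -/
def orR : Fm.{u} → Option Fm.{u} → Fm.{u}
  | c, none => c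
  | c, some b => .or c b

/-- The free variable `(τ)ᵢ` does not occur in the formula, if there is one. -/
def Fresh (τ : Ty.{u}) (i : ℕ) (a : Option Fm.{u}) : Prop := ∀ c ∈ a, ¬ c.Occurs τ i

/-! ### The proper deductive calculus -/

/-- `ProperThm lam a b`: `a ⟹ b` is a theorem of the proper deductive calculus.  An omitted left side
takes the place of `1`, an omitted right side that of `0`. -/
inductive ProperThm (lam : Ordinal.{u}) : Option Fm.{u} → Option Fm.{u} → Prop
  | refl {c : Fm.{u}} (hc : IsFormula lam .proper c) : ProperThm lam (some c) (some c)
  | comp {ν : Ordinal.{u}} {n : ℕ} {τs : Fin n → Ty.{u}} {c : Fm.{u}}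
      (hc : IsFm lam .proper ν (ctx τs) c) (h : IsFormula lam .proper (comprehension ν n τs c)) :
      ProperThm lam none (some (comprehension ν n τs c))
  | ext {ν : Ordinal.{u}} {n : ℕ} {τs : Fin n → Ty.{u}} {c : Fm.{u}} {i j : ℕ}
      (hτ : (Ty.rel ν n τs).WF lam) (hc : IsFormulaIn lam .proper [.rel ν n τs] c) :
      ProperThm lam (some (coext n τs (.fvar (.rel ν n τs) i) (.fvar (.rel ν n τs) j)))
        (some ((c.inst1 (.fvar (.rel ν n τs) i)).imp (c.inst1 (.fvar (.rel ν n τs) j))))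
  | inf (h : IsFormula.{u} lam .proper infinity) : ProperThm lam none (some infinity)
  | cut {a b : Option Fm.{u}} {c : Fm.{u}} (h₁ : ProperThm lam a (some c))
      (h₂ : ProperThm lam (some c) b) : ProperThm lam a b
  | and_left₁ {a b : Option Fm.{u}} {c : Fm.{u}} (hc : IsFormula lam .proper c)
      (h : ProperThm lam a b) : ProperThm lam (some (andL a c)) b
  | and_left₂ {a b : Option Fm.{u}} {c : Fm.{u}} (hc : IsFormula lam .proper c)
      (h : ProperThm lam a b) : ProperThm lam (some (andR c a)) b
  | or_right₁ {a b : Option Fm.{u}} {c : Fm.{u}} (hc : IsFormula lam .proper c)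
      (h : ProperThm lam a b) : ProperThm lam a (some (orL b c))
  | or_right₂ {a b : Option Fm.{u}} {c : Fm.{u}} (hc : IsFormula lam .proper c)
      (h : ProperThm lam a b) : ProperThm lam a (some (orR c b))
  | and_right {a : Option Fm.{u}} {b₁ b₂ : Fm.{u}} (h₁ : ProperThm lam a (some b₁))
      (h₂ : ProperThm lam a (some b₂)) : ProperThm lam a (some (.and b₁ b₂))
  | or_left {a₁ a₂ : Fm.{u}} {b : Option Fm.{u}} (h₁ : ProperThm lam (some a₁) b)
      (h₂ : ProperThm lam (some a₂) b) : ProperThm lam (some (.or a₁ a₂)) b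
  | neg_right {a b : Option Fm.{u}} {c : Fm.{u}} (h : ProperThm lam (some (andL a c)) b) :
      ProperThm lam a (some (orL b (.neg c)))
  | neg_left {a b : Option Fm.{u}} {c : Fm.{u}} (h : ProperThm lam a (some (orL b c))) :
      ProperThm lam (some (andL a (.neg c))) b
  | all_spec {a : Option Fm.{u}} {c : Fm.{u}} {τ : Ty.{u}} {i : ℕ}
      (h : ProperThm lam a (some (.all τ c))) : ProperThm lam a (some (c.inst1 (.fvar τ i)))
  | ex_spec {b : Option Fm.{u}} {c : Fm.{u}} {τ : Ty.{u}} {i : ℕ}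
      (h : ProperThm lam (some (.ex τ c)) b) : ProperThm lam (some (c.inst1 (.fvar τ i))) b
  | all_right {a : Option Fm.{u}} {c : Fm.{u}} {τ : Ty.{u}} {i : ℕ}
      (hc : IsFormula lam .proper (.all τ c)) (ha : Fresh τ i a) (hi : ¬ c.Occurs τ i)
      (h : ProperThm lam a (some (c.inst1 (.fvar τ i)))) : ProperThm lam a (some (.all τ c))
  | ex_left {b : Option Fm.{u}} {c : Fm.{u}} {τ : Ty.{u}} {i : ℕ}
      (hc : IsFormula lam .proper (.ex τ c)) (hb : Fresh τ i b) (hi : ¬ c.Occurs τ i)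
      (h : ProperThm lam (some (c.inst1 (.fvar τ i))) b) : ProperThm lam (some (.ex τ c)) b

/-! ### The inductive calculus -/

/-- One step of association, transposition or contraction in a conjunction `a₁ ∧ ⋯ ∧ aₘ`. -/
inductive AndStep : Fm.{u} → Fm.{u} → Prop
  | assoc₁ (a b c : Fm.{u}) : AndStep (.and (.and a b) c) (.and a (.and b c))
  | assoc₂ (a b c : Fm.{u}) : AndStep (.and a (.and b c)) (.and (.and a b) c)
  | comm (a b : Fm.{u}) : AndStep (.and a b) (.and b a)
  | contr (a : Fm.{u}) : AndStep (.and a a) a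
  | left {a a' : Fm.{u}} (b : Fm.{u}) (h : AndStep a a') : AndStep (.and a b) (.and a' b)
  | right (a : Fm.{u}) {b b' : Fm.{u}} (h : AndStep b b') : AndStep (.and a b) (.and a b')

/-- One step of association, transposition or contraction in a disjunction `b₁ ∨ ⋯ ∨ bₙ`. -/
inductive OrStep : Fm.{u} → Fm.{u} → Prop
  | assoc₁ (a b c : Fm.{u}) : OrStep (.or (.or a b) c) (.or a (.or b c))
  | assoc₂ (a b c : Fm.{u}) : OrStep (.or a (.or b c)) (.or (.or a b) c)
  | comm (a b : Fm.{u}) : OrStep (.or a b) (.or b a)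
  | contr (a : Fm.{u}) : OrStep (.or a a) a
  | left {a a' : Fm.{u}} (b : Fm.{u}) (h : OrStep a a') : OrStep (.or a b) (.or a' b)
  | right (a : Fm.{u}) {b b' : Fm.{u}} (h : OrStep b b') : OrStep (.or a b) (.or a b')

open Classical in
/-- `c/a`, the elimination of the constant `a = (x₁ … xₙ)^ν a(x₁, …, xₙ)` in `c`: every prime formula
`a c₁ … cₙ` beginning with `a` is replaced by `a(c₁, …, cₙ)`. -/
noncomputable def Fm.eliminate (a : Tm.{u}) : Fm.{u} → Fm.{u}
  | .bot => .bot
  | .top => .top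
  | .gt s t => .gt s t
  | .app f n ts =>
    if f = a then
      match f with
      | .cst _ _ _ body => body.inst n ts
      | f => .app f n ts
    else .app f n ts
  | .and c d => .and (c.eliminate a) (d.eliminate a)
  | .or c d => .or (c.eliminate a) (d.eliminate a)
  | .neg c => .neg (c.eliminate a)
  | .all τ c => .all τ (c.eliminate a)
  | .ex τ c => .ex τ (c.eliminate a)

/-- `IndThm lam a b`: `a ⟹ b` is a theorem of the inductive calculus. -/
inductive IndThm (lam : Ordinal.{u}) : Option Fm.{u} → Option Fm.{u} → Prop
  | num_true {k l : ℕ} (hf : IsFormula.{u} lam .ind (.gt (.num k) (.num l))) (h : k > l) :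
      IndThm lam none (some (.gt (.num k) (.num l)))
  | num_false {k l : ℕ} (hf : IsFormula.{u} lam .ind (.gt (.num k) (.num l))) (h : ¬ k > l) :
      IndThm lam (some (.gt (.num k) (.num l))) none
  | struct_left {a a' : Fm.{u}} {b : Option Fm.{u}} (hs : AndStep a a')
      (h : IndThm lam (some a) b) : IndThm lam (some a') b
  | struct_right {a : Option Fm.{u}} {b b' : Fm.{u}} (hs : OrStep b b')
      (h : IndThm lam a (some b)) : IndThm lam a (some b')
  | weak_right {a b : Option Fm.{u}} {c : Fm.{u}} (hc : IsFormula lam .ind c)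
      (h : IndThm lam a b) : IndThm lam a (some (orL b c))
  | weak_left {a b : Option Fm.{u}} {c : Fm.{u}} (hc : IsFormula lam .ind c)
      (h : IndThm lam a b) : IndThm lam (some (andL a c)) b
  | and_right {a c : Option Fm.{u}} {b₁ b₂ : Fm.{u}} (h₁ : IndThm lam a (some (orR b₁ c)))
      (h₂ : IndThm lam a (some (orR b₂ c))) : IndThm lam a (some (orR (.and b₁ b₂) c))
  | or_left {b c : Option Fm.{u}} {a₁ a₂ : Fm.{u}} (h₁ : IndThm lam (some (andR a₁ c)) b)
      (h₂ : IndThm lam (some (andR a₂ c)) b) : IndThm lam (some (andR (.or a₁ a₂) c)) b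
  | neg_right {a b : Option Fm.{u}} {c : Fm.{u}} (h : IndThm lam (some (andL a c)) b) :
      IndThm lam a (some (orL b (.neg c)))
  | neg_left {a b : Option Fm.{u}} {c : Fm.{u}} (h : IndThm lam a (some (orL b c))) :
      IndThm lam (some (andL a (.neg c))) b
  | all_right {a b : Option Fm.{u}} {c : Fm.{u}} {τ : Ty.{u}} {i : ℕ}
      (hc : IsFormula lam .ind (.all τ c)) (ha : Fresh τ i a) (hb : Fresh τ i b)
      (hi : ¬ c.Occurs τ i) (h : IndThm lam a (some (orL b (c.inst1 (.fvar τ i))))) :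
      IndThm lam a (some (orL b (.all τ c)))
  | ex_left {a b : Option Fm.{u}} {c : Fm.{u}} {τ : Ty.{u}} {i : ℕ}
      (hc : IsFormula lam .ind (.ex τ c)) (ha : Fresh τ i a) (hb : Fresh τ i b)
      (hi : ¬ c.Occurs τ i) (h : IndThm lam (some (andL a (c.inst1 (.fvar τ i)))) b) :
      IndThm lam (some (andL a (.ex τ c))) b
  | all_left {a b : Option Fm.{u}} {c : Fm.{u}} {τ : Ty.{u}} {t : Tm.{u}}
      (hc : IsFormula lam .ind (.all τ c)) (ht : IsConst lam t τ)
      (h : IndThm lam (some (andL a (c.inst1 t))) b) : IndThm lam (some (andL a (.all τ c))) b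
  | ex_right {a b : Option Fm.{u}} {c : Fm.{u}} {τ : Ty.{u}} {t : Tm.{u}}
      (hc : IsFormula lam .ind (.ex τ c)) (ht : IsConst lam t τ)
      (h : IndThm lam a (some (orL b (c.inst1 t)))) : IndThm lam a (some (orL b (.ex τ c)))
  | induction {a b : Option Fm.{u}} {τ : Ty.{u}} {i : ℕ} (hτ : τ.WF lam)
      (ha : ∀ c ∈ a, IsFormula lam .ind c) (hb : ∀ c ∈ b, IsFormula lam .ind c)
      (h : ∀ t, IsConst lam t τ → IndThm lam (a.map (Fm.replace τ i t)) (b.map (Fm.replace τ i t))) :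
      IndThm lam a b
  | constants {a b : Option Fm.{u}} {ν : Ordinal.{u}} {n : ℕ} {τs : Fin n → Ty.{u}} {t : Tm.{u}}
      (ht : IsConst lam t (.rel ν n τs))
      (ha : ∀ c ∈ a, IsFormula lam .ind c) (hb : ∀ c ∈ b, IsFormula lam .ind c)
      (h : IndThm lam (a.map (Fm.eliminate t)) (b.map (Fm.eliminate t))) : IndThm lam a b

end Ramified

namespace Ramified

variable {lam : Ordinal.{u}}

/-! ### Algebra of renaming and substitution -/

theorem upRen_comp (n : ℕ) (ρ ρ' : ℕ → ℕ) : upRen n ρ' ∘ upRen n ρ = upRen n (ρ' ∘ ρ) := by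
  funext k
  by_cases h : k < n <;> simp [upRen, h]

mutual

theorem Tm.rename_rename (ρ ρ' : ℕ → ℕ) : ∀ t : Tm.{u}, (t.rename ρ).rename ρ' = t.rename (ρ' ∘ ρ)
  | .fvar τ i => rfl
  | .bvar k => rfl
  | .num k => rfl
  | .cst ν n τs c => by simp only [Tm.rename, Fm.rename_rename _ _ c, upRen_comp]

theorem Fm.rename_rename (ρ ρ' : ℕ → ℕ) : ∀ c : Fm.{u}, (c.rename ρ).rename ρ' = c.rename (ρ' ∘ ρ)
  | .bot => rfl
  | .top => rfl
  | .gt s t => by simp only [Fm.rename, Tm.rename_rename _ _ s, Tm.rename_rename _ _ t]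
  | .app f n ts => by
    simp only [Fm.rename, Tm.rename_rename _ _ f, fun j => Tm.rename_rename ρ ρ' (ts j)]
  | .and a b => by simp only [Fm.rename, Fm.rename_rename _ _ a, Fm.rename_rename _ _ b]
  | .or a b => by simp only [Fm.rename, Fm.rename_rename _ _ a, Fm.rename_rename _ _ b]
  | .neg a => by simp only [Fm.rename, Fm.rename_rename _ _ a]
  | .all τ c => by simp only [Fm.rename, Fm.rename_rename _ _ c, upRen_comp]
  | .ex τ c => by simp only [Fm.rename, Fm.rename_rename _ _ c, upRen_comp]

end

theorem upBound_comp_upRen (n : ℕ) (ρ : ℕ → ℕ) (σ : ℕ → Tm.{u}) :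
    upBound n σ ∘ upRen n ρ = upBound n (σ ∘ ρ) := by
  funext k
  by_cases h : k < n <;> simp [upRen, upBound, h]

mutual

theorem Tm.subst_rename (ρ : ℕ → ℕ) (θ : Ty.{u} → ℕ → Tm.{u}) (σ : ℕ → Tm.{u}) :
    ∀ t : Tm.{u}, (t.rename ρ).subst θ σ = t.subst θ (σ ∘ ρ)
  | .fvar τ i => rfl
  | .bvar k => rfl
  | .num k => rfl
  | .cst ν n τs c => by
    simp only [Tm.rename, Tm.subst, Fm.subst_rename _ _ _ c, upBound_comp_upRen]

theorem Fm.subst_rename (ρ : ℕ → ℕ) (θ : Ty.{u} → ℕ → Tm.{u}) (σ : ℕ → Tm.{u}) :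
    ∀ c : Fm.{u}, (c.rename ρ).subst θ σ = c.subst θ (σ ∘ ρ)
  | .bot => rfl
  | .top => rfl
  | .gt s t => by simp only [Fm.rename, Fm.subst, Tm.subst_rename _ _ _ s, Tm.subst_rename _ _ _ t]
  | .app f n ts => by
    simp only [Fm.rename, Fm.subst, Tm.subst_rename _ _ _ f,
      fun j => Tm.subst_rename ρ θ σ (ts j)]
  | .and a b => by simp only [Fm.rename, Fm.subst, Fm.subst_rename _ _ _ a, Fm.subst_rename _ _ _ b]
  | .or a b => by simp only [Fm.rename, Fm.subst, Fm.subst_rename _ _ _ a, Fm.subst_rename _ _ _ b]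
  | .neg a => by simp only [Fm.rename, Fm.subst, Fm.subst_rename _ _ _ a]
  | .all τ c => by simp only [Fm.rename, Fm.subst, Fm.subst_rename _ _ _ c, upBound_comp_upRen]
  | .ex τ c => by simp only [Fm.rename, Fm.subst, Fm.subst_rename _ _ _ c, upBound_comp_upRen]

end

theorem Tm.rename_shift (n : ℕ) (ρ : ℕ → ℕ) (t : Tm.{u}) :
    (t.rename (fun k => k + n)).rename (upRen n ρ) = (t.rename ρ).rename (fun k => k + n) := by
  rw [Tm.rename_rename, Tm.rename_rename]
  congr 1
  funext k
  simp [upRen]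

theorem rename_upFree (n : ℕ) (ρ : ℕ → ℕ) (θ : Ty.{u} → ℕ → Tm.{u}) :
    (fun τ i => (upFree n θ τ i).rename (upRen n ρ)) = upFree n (fun τ i => (θ τ i).rename ρ) := by
  funext τ i
  exact Tm.rename_shift n ρ (θ τ i)

theorem rename_upBound (n : ℕ) (ρ : ℕ → ℕ) (σ : ℕ → Tm.{u}) :
    (fun k => (upBound n σ k).rename (upRen n ρ)) = upBound n (fun k => (σ k).rename ρ) := by
  funext k
  by_cases h : k < n
  · simp [upBound, h, Tm.rename, upRen]
  · simp [upBound, h, Tm.rename_shift]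

mutual

theorem Tm.rename_subst (ρ : ℕ → ℕ) (θ : Ty.{u} → ℕ → Tm.{u}) (σ : ℕ → Tm.{u}) :
    ∀ t : Tm.{u}, (t.subst θ σ).rename ρ =
      t.subst (fun τ i => (θ τ i).rename ρ) (fun k => (σ k).rename ρ)
  | .fvar τ i => rfl
  | .bvar k => rfl
  | .num k => rfl
  | .cst ν n τs c => by
    simp only [Tm.rename, Tm.subst, Fm.rename_subst _ _ _ c, rename_upFree, rename_upBound]

theorem Fm.rename_subst (ρ : ℕ → ℕ) (θ : Ty.{u} → ℕ → Tm.{u}) (σ : ℕ → Tm.{u}) :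
    ∀ c : Fm.{u}, (c.subst θ σ).rename ρ =
      c.subst (fun τ i => (θ τ i).rename ρ) (fun k => (σ k).rename ρ)
  | .bot => rfl
  | .top => rfl
  | .gt s t => by simp only [Fm.rename, Fm.subst, Tm.rename_subst _ _ _ s, Tm.rename_subst _ _ _ t]
  | .app f n ts => by
    simp only [Fm.rename, Fm.subst, Tm.rename_subst _ _ _ f,
      fun j => Tm.rename_subst ρ θ σ (ts j)]
  | .and a b => by simp only [Fm.rename, Fm.subst, Fm.rename_subst _ _ _ a, Fm.rename_subst _ _ _ b]
  | .or a b => by simp only [Fm.rename, Fm.subst, Fm.rename_subst _ _ _ a, Fm.rename_subst _ _ _ b]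
  | .neg a => by simp only [Fm.rename, Fm.subst, Fm.rename_subst _ _ _ a]
  | .all τ c => by
    simp only [Fm.rename, Fm.subst, Fm.rename_subst _ _ _ c, rename_upFree, rename_upBound]
  | .ex τ c => by
    simp only [Fm.rename, Fm.subst, Fm.rename_subst _ _ _ c, rename_upFree, rename_upBound]

end

theorem Tm.subst_shift (n : ℕ) (θ : Ty.{u} → ℕ → Tm.{u}) (σ : ℕ → Tm.{u}) (t : Tm.{u}) :
    (t.rename (fun k => k + n)).subst (upFree n θ) (upBound n σ) =
      (t.subst θ σ).rename (fun k => k + n) := by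
  rw [Tm.subst_rename, Tm.rename_subst]
  congr 1
  funext k
  simp [upBound]

theorem subst_upFree (n : ℕ) (θ θ' : Ty.{u} → ℕ → Tm.{u}) (σ' : ℕ → Tm.{u}) :
    (fun τ i => (upFree n θ τ i).subst (upFree n θ') (upBound n σ')) =
      upFree n (fun τ i => (θ τ i).subst θ' σ') := by
  funext τ i
  exact Tm.subst_shift n θ' σ' (θ τ i)

theorem subst_upBound (n : ℕ) (σ : ℕ → Tm.{u}) (θ' : Ty.{u} → ℕ → Tm.{u}) (σ' : ℕ → Tm.{u}) :
    (fun k => (upBound n σ k).subst (upFree n θ') (upBound n σ')) =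
      upBound n (fun k => (σ k).subst θ' σ') := by
  funext k
  by_cases h : k < n
  · simp [upBound, h, Tm.subst]
  · simp [upBound, h, Tm.subst_shift]

mutual

theorem Tm.subst_subst (θ : Ty.{u} → ℕ → Tm.{u}) (σ : ℕ → Tm.{u}) (θ' : Ty.{u} → ℕ → Tm.{u})
    (σ' : ℕ → Tm.{u}) : ∀ t : Tm.{u}, (t.subst θ σ).subst θ' σ' =
      t.subst (fun τ i => (θ τ i).subst θ' σ') (fun k => (σ k).subst θ' σ')
  | .fvar τ i => rfl
  | .bvar k => rfl
  | .num k => rfl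
  | .cst ν n τs c => by
    simp only [Tm.subst, Fm.subst_subst _ _ _ _ c, subst_upFree, subst_upBound]

theorem Fm.subst_subst (θ : Ty.{u} → ℕ → Tm.{u}) (σ : ℕ → Tm.{u}) (θ' : Ty.{u} → ℕ → Tm.{u})
    (σ' : ℕ → Tm.{u}) : ∀ c : Fm.{u}, (c.subst θ σ).subst θ' σ' =
      c.subst (fun τ i => (θ τ i).subst θ' σ') (fun k => (σ k).subst θ' σ')
  | .bot => rfl
  | .top => rfl
  | .gt s t => by simp only [Fm.subst, Tm.subst_subst _ _ _ _ s, Tm.subst_subst _ _ _ _ t]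
  | .app f n ts => by
    simp only [Fm.subst, Tm.subst_subst _ _ _ _ f, fun j => Tm.subst_subst θ σ θ' σ' (ts j)]
  | .and a b => by simp only [Fm.subst, Fm.subst_subst _ _ _ _ a, Fm.subst_subst _ _ _ _ b]
  | .or a b => by simp only [Fm.subst, Fm.subst_subst _ _ _ _ a, Fm.subst_subst _ _ _ _ b]
  | .neg a => by simp only [Fm.subst, Fm.subst_subst _ _ _ _ a]
  | .all τ c => by simp only [Fm.subst, Fm.subst_subst _ _ _ _ c, subst_upFree, subst_upBound]
  | .ex τ c => by simp only [Fm.subst, Fm.subst_subst _ _ _ _ c, subst_upFree, subst_upBound]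

end

theorem upFree_fvar (n : ℕ) : upFree n Tm.fvar.{u} = Tm.fvar := rfl

theorem upBound_bvar (n : ℕ) : upBound n Tm.bvar.{u} = Tm.bvar := by
  funext k
  by_cases h : k < n
  · simp [upBound, h]
  · simp only [upBound, h, if_false, Tm.rename]
    congr 1
    omega

mutual

theorem Tm.subst_id : ∀ t : Tm.{u}, t.subst Tm.fvar Tm.bvar = t
  | .fvar τ i => rfl
  | .bvar k => rfl
  | .num k => rfl
  | .cst ν n τs c => by simp only [Tm.subst, upFree_fvar, upBound_bvar, Fm.subst_id c]

theorem Fm.subst_id : ∀ c : Fm.{u}, c.subst Tm.fvar Tm.bvar = c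
  | .bot => rfl
  | .top => rfl
  | .gt s t => by simp only [Fm.subst, Tm.subst_id s, Tm.subst_id t]
  | .app f n ts => by simp only [Fm.subst, Tm.subst_id f, fun j => Tm.subst_id (ts j)]
  | .and a b => by simp only [Fm.subst, Fm.subst_id a, Fm.subst_id b]
  | .or a b => by simp only [Fm.subst, Fm.subst_id a, Fm.subst_id b]
  | .neg a => by simp only [Fm.subst, Fm.subst_id a]
  | .all τ c => by simp only [Fm.subst, upFree_fvar, upBound_bvar, Fm.subst_id c]
  | .ex τ c => by simp only [Fm.subst, upFree_fvar, upBound_bvar, Fm.subst_id c]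

end

/-- The substitution `σ` for the indices, preceded by the arguments `ts` of `n` binders. -/
def consN (n : ℕ) (ts : Fin n → Tm.{u}) (σ : ℕ → Tm.{u}) (k : ℕ) : Tm.{u} :=
  if h : k < n then ts (Fin.rev ⟨k, h⟩) else σ (k - n)

theorem Fm.inst_eq (c : Fm.{u}) (n : ℕ) (ts : Fin n → Tm.{u}) :
    c.inst n ts = c.subst Tm.fvar (consN n ts Tm.bvar) := rfl

theorem consN_add (n : ℕ) (ts : Fin n → Tm.{u}) (σ : ℕ → Tm.{u}) (k : ℕ) :
    consN n ts σ (k + n) = σ k := by simp [consN]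

theorem consN_rev {n : ℕ} (ts : Fin n → Tm.{u}) (σ : ℕ → Tm.{u}) (j : Fin n) :
    consN n ts σ (j.rev : ℕ) = ts j := by
  simp only [consN, Fin.is_lt, dite_true, Fin.eta, Fin.rev_rev]

theorem consN_cons {n : ℕ} (t : Tm.{u}) (ts : Fin n → Tm.{u}) (σ : ℕ → Tm.{u}) :
    consN n ts (consN 1 (fun _ => t) σ) = consN (n + 1) (Fin.cons t ts) σ := by
  funext k
  rcases lt_trichotomy k n with h | rfl | h
  · have : (Fin.rev ⟨k, by omega⟩ : Fin (n + 1)) = (Fin.rev ⟨k, h⟩ : Fin n).succ := by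
      ext; simp [Fin.rev]; omega
    simp only [consN, h, show k < n + 1 by omega, dite_true, this, Fin.cons_succ]
  · have : (Fin.rev ⟨k, by omega⟩ : Fin (k + 1)) = 0 := by ext; simp [Fin.rev]
    simp [consN, this]
  · have h1 : ¬ k < n := by omega
    have h2 : ¬ k < n + 1 := by omega
    have h3 : ¬ k - n < 1 := by omega
    simp only [consN, h1, h2, h3, dite_false]
    congr 1

/-- Substitution into an instance. -/
theorem Fm.subst_inst (c : Fm.{u}) (n : ℕ) (ts : Fin n → Tm.{u}) (θ : Ty.{u} → ℕ → Tm.{u})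
    (σ : ℕ → Tm.{u}) : (c.inst n ts).subst θ σ =
      c.subst θ (consN n (fun j => (ts j).subst θ σ) σ) := by
  rw [Fm.inst_eq, Fm.subst_subst]
  congr 1
  funext k
  by_cases h : k < n <;> simp [consN, h, Tm.subst]

/-- Instantiation of a substituted body. -/
theorem Fm.inst_subst (c : Fm.{u}) (n : ℕ) (ts : Fin n → Tm.{u}) (θ : Ty.{u} → ℕ → Tm.{u})
    (σ : ℕ → Tm.{u}) : (c.subst (upFree n θ) (upBound n σ)).inst n ts =
      c.subst θ (consN n ts σ) := by
  have key : ∀ t : Tm.{u}, (t.rename (fun k => k + n)).subst Tm.fvar (consN n ts Tm.bvar) = t := by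
    intro t
    rw [Tm.subst_rename]
    have : consN n ts Tm.bvar ∘ (fun k => k + n) = Tm.bvar := by
      funext k; exact consN_add n ts _ k
    rw [this, Tm.subst_id]
  rw [Fm.inst_eq, Fm.subst_subst]
  congr 1
  · funext τ i; exact key _
  · funext k
    by_cases h : k < n
    · simp [upBound, consN, h, Tm.subst]
    · simp [upBound, h, key, consN]

/-! ### Occurrences of free variables -/

mutual

theorem Tm.occurs_rename (ρ : ℕ → ℕ) (τ : Ty.{u}) (i : ℕ) :
    ∀ t : Tm.{u}, (t.rename ρ).Occurs τ i ↔ t.Occurs τ i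
  | .fvar _ _ => Iff.rfl
  | .bvar _ => Iff.rfl
  | .num _ => Iff.rfl
  | .cst ν n τs c => by simp only [Tm.rename, Tm.Occurs, Fm.occurs_rename _ _ _ c]

theorem Fm.occurs_rename (ρ : ℕ → ℕ) (τ : Ty.{u}) (i : ℕ) :
    ∀ c : Fm.{u}, (c.rename ρ).Occurs τ i ↔ c.Occurs τ i
  | .bot => Iff.rfl
  | .top => Iff.rfl
  | .gt s t => by
    simp only [Fm.rename, Fm.Occurs, Tm.occurs_rename _ _ _ s, Tm.occurs_rename _ _ _ t]
  | .app f n ts => by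
    simp only [Fm.rename, Fm.Occurs, Tm.occurs_rename _ _ _ f,
      fun j => Tm.occurs_rename ρ τ i (ts j)]
  | .and a b => by
    simp only [Fm.rename, Fm.Occurs, Fm.occurs_rename _ _ _ a, Fm.occurs_rename _ _ _ b]
  | .or a b => by
    simp only [Fm.rename, Fm.Occurs, Fm.occurs_rename _ _ _ a, Fm.occurs_rename _ _ _ b]
  | .neg a => by simp only [Fm.rename, Fm.Occurs, Fm.occurs_rename _ _ _ a]
  | .all τ c => by simp only [Fm.rename, Fm.Occurs, Fm.occurs_rename _ _ _ c]
  | .ex τ c => by simp only [Fm.rename, Fm.Occurs, Fm.occurs_rename _ _ _ c]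

end

theorem occurs_upBound {n : ℕ} {σ : ℕ → Tm.{u}} {τ : Ty.{u}} {i : ℕ}
    (h : ∃ k, (upBound n σ k).Occurs τ i) : ∃ k, (σ k).Occurs τ i := by
  obtain ⟨k, hk⟩ := h
  by_cases hn : k < n
  · simp [upBound, hn, Tm.Occurs] at hk
  · simp only [upBound, hn, if_false, Tm.occurs_rename] at hk
    exact ⟨_, hk⟩

mutual

theorem Tm.occurs_subst {τ : Ty.{u}} {i : ℕ} : ∀ {θ : Ty.{u} → ℕ → Tm.{u}} {σ : ℕ → Tm.{u}}
    (t : Tm.{u}), (t.subst θ σ).Occurs τ i →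
      (∃ τ' i', t.Occurs τ' i' ∧ (θ τ' i').Occurs τ i) ∨ ∃ k, (σ k).Occurs τ i
  | θ, σ, .fvar τ' i', h => .inl ⟨τ', i', ⟨rfl, rfl⟩, h⟩
  | θ, σ, .bvar k, h => .inr ⟨k, h⟩
  | θ, σ, .num _, h => h.elim
  | θ, σ, .cst ν n τs c, h => by
    refine (Fm.occurs_subst c h).imp ?_ occurs_upBound
    rintro ⟨τ', i', h1, h2⟩
    exact ⟨τ', i', h1, (Tm.occurs_rename _ _ _ _).1 h2⟩

theorem Fm.occurs_subst {τ : Ty.{u}} {i : ℕ} : ∀ {θ : Ty.{u} → ℕ → Tm.{u}} {σ : ℕ → Tm.{u}}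
    (c : Fm.{u}), (c.subst θ σ).Occurs τ i →
      (∃ τ' i', c.Occurs τ' i' ∧ (θ τ' i').Occurs τ i) ∨ ∃ k, (σ k).Occurs τ i
  | θ, σ, .bot, h => h.elim
  | θ, σ, .top, h => h.elim
  | θ, σ, .gt s t, h => by
    rcases h with h | h
    · exact (Tm.occurs_subst s h).imp_left fun ⟨τ', i', h1, h2⟩ => ⟨τ', i', .inl h1, h2⟩
    · exact (Tm.occurs_subst t h).imp_left fun ⟨τ', i', h1, h2⟩ => ⟨τ', i', .inr h1, h2⟩
  | θ, σ, .app f n ts, h => by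
    rcases h with h | ⟨j, h⟩
    · exact (Tm.occurs_subst f h).imp_left fun ⟨τ', i', h1, h2⟩ => ⟨τ', i', .inl h1, h2⟩
    · exact (Tm.occurs_subst (ts j) h).imp_left
        fun ⟨τ', i', h1, h2⟩ => ⟨τ', i', .inr ⟨j, h1⟩, h2⟩
  | θ, σ, .and s t, h => by
    rcases h with h | h
    · exact (Fm.occurs_subst s h).imp_left fun ⟨τ', i', h1, h2⟩ => ⟨τ', i', .inl h1, h2⟩
    · exact (Fm.occurs_subst t h).imp_left fun ⟨τ', i', h1, h2⟩ => ⟨τ', i', .inr h1, h2⟩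
  | θ, σ, .or s t, h => by
    rcases h with h | h
    · exact (Fm.occurs_subst s h).imp_left fun ⟨τ', i', h1, h2⟩ => ⟨τ', i', .inl h1, h2⟩
    · exact (Fm.occurs_subst t h).imp_left fun ⟨τ', i', h1, h2⟩ => ⟨τ', i', .inr h1, h2⟩
  | θ, σ, .neg a, h => Fm.occurs_subst a h
  | θ, σ, .all _ c, h => by
    refine (Fm.occurs_subst c h).imp ?_ occurs_upBound
    rintro ⟨τ', i', h1, h2⟩
    exact ⟨τ', i', h1, (Tm.occurs_rename _ _ _ _).1 h2⟩
  | θ, σ, .ex _ c, h => by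
    refine (Fm.occurs_subst c h).imp ?_ occurs_upBound
    rintro ⟨τ', i', h1, h2⟩
    exact ⟨τ', i', h1, (Tm.occurs_rename _ _ _ _).1 h2⟩

end

mutual

theorem Tm.finite_occurs : ∀ t : Tm.{u}, {p : Ty.{u} × ℕ | t.Occurs p.1 p.2}.Finite
  | .fvar τ i => (Set.finite_singleton (τ, i)).subset fun _ h => Prod.ext h.1.symm h.2.symm
  | .bvar _ => Set.finite_empty
  | .num _ => Set.finite_empty
  | .cst _ _ _ c => Fm.finite_occurs c

theorem Fm.finite_occurs : ∀ c : Fm.{u}, {p : Ty.{u} × ℕ | c.Occurs p.1 p.2}.Finite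
  | .bot => Set.finite_empty
  | .top => Set.finite_empty
  | .gt s t => (Tm.finite_occurs s).union (Tm.finite_occurs t)
  | .app f _ ts => ((Tm.finite_occurs f).union
      (Set.finite_iUnion fun j => Tm.finite_occurs (ts j))).subset
        fun _ h => h.imp_right fun ⟨j, hj⟩ => Set.mem_iUnion.2 ⟨j, hj⟩
  | .and a b => (Fm.finite_occurs a).union (Fm.finite_occurs b)
  | .or a b => (Fm.finite_occurs a).union (Fm.finite_occurs b)
  | .neg a => Fm.finite_occurs a
  | .all _ c => Fm.finite_occurs c
  | .ex _ c => Fm.finite_occurs c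

end

/-! ### Typing -/

/-- All types listed in `Γ` are types below `lam`. -/
def CtxWF (lam : Ordinal.{u}) (Γ : List Ty.{u}) : Prop := ∀ τ ∈ Γ, τ.WF lam

theorem CtxWF.nil : CtxWF lam [] := fun _ h => absurd h List.not_mem_nil

theorem CtxWF.cons {Γ : List Ty.{u}} {τ : Ty.{u}} (hτ : τ.WF lam) (h : CtxWF lam Γ) :
    CtxWF lam (τ :: Γ) := by
  intro σ hσ
  rcases List.mem_cons.1 hσ with rfl | hσ
  exacts [hτ, h _ hσ]

theorem mem_ctx {n : ℕ} {τs : Fin n → Ty.{u}} {τ : Ty.{u}} : τ ∈ ctx τs ↔ ∃ j, τs j = τ := by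
  simp only [ctx, List.mem_ofFn]
  exact ⟨fun ⟨j, h⟩ => ⟨_, h⟩, fun ⟨j, h⟩ => ⟨j.rev, by simpa using h⟩⟩

theorem length_ctx {n : ℕ} (τs : Fin n → Ty.{u}) : (ctx τs).length = n := by simp [ctx]

theorem Ty.WF.lt {ν : Ordinal.{u}} {n : ℕ} {τs : Fin n → Ty.{u}} (h : (Ty.rel ν n τs).WF lam) :
    ν < lam := by
  rw [Ty.WF] at h
  exact h.1

theorem Ty.WF.arity_pos {ν : Ordinal.{u}} {n : ℕ} {τs : Fin n → Ty.{u}}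
    (h : (Ty.rel ν n τs).WF lam) : 0 < n := by
  rw [Ty.WF] at h
  exact h.2.1

theorem Ty.WF.arg {ν : Ordinal.{u}} {n : ℕ} {τs : Fin n → Ty.{u}} (h : (Ty.rel ν n τs).WF lam)
    (j : Fin n) : (τs j).WF lam := by
  rw [Ty.WF] at h
  exact (h.2.2 j).1

theorem Ty.WF.arg_lt {ν : Ordinal.{u}} {n : ℕ} {τs : Fin n → Ty.{u}}
    (h : (Ty.rel ν n τs).WF lam) (j : Fin n) : (τs j).order < ν := by
  rw [Ty.WF] at h
  exact (h.2.2 j).2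

theorem Ty.WF.pos {ν : Ordinal.{u}} {n : ℕ} {τs : Fin n → Ty.{u}} (h : (Ty.rel ν n τs).WF lam) :
    0 < ν := (zero_le).trans_lt (h.arg_lt ⟨0, h.arity_pos⟩)

theorem CtxWF.append {Γ : List Ty.{u}} {ν : Ordinal.{u}} {n : ℕ} {τs : Fin n → Ty.{u}}
    (hτ : (Ty.rel ν n τs).WF lam) (h : CtxWF lam Γ) : CtxWF lam (ctx τs ++ Γ) := by
  intro σ hσ
  rcases List.mem_append.1 hσ with hσ | hσ
  · obtain ⟨j, rfl⟩ := mem_ctx.1 hσ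
    exact hτ.arg j
  · exact h _ hσ

theorem CtxWF.ctx {ν : Ordinal.{u}} {n : ℕ} {τs : Fin n → Ty.{u}}
    (hτ : (Ty.rel ν n τs).WF lam) : CtxWF lam (ctx τs) := by
  simpa using CtxWF.nil.append hτ

theorem CtxWF.getElem? {Γ : List Ty.{u}} (h : CtxWF lam Γ) {k : ℕ} {τ : Ty.{u}}
    (hk : Γ[k]? = some τ) : τ.WF lam := h _ (List.mem_of_getElem? hk)

theorem IsTm.wf_rel {K : Calc} {Γ : List Ty.{u}} {t : Tm.{u}} {ν : Ordinal.{u}} {n : ℕ}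
    {τs : Fin n → Ty.{u}} (hΓ : CtxWF lam Γ) (h : IsTm lam K Γ t (.rel ν n τs)) :
    (Ty.rel ν n τs).WF lam := by
  cases h with
  | fvar hτ => exact hτ
  | bvar h => exact hΓ.getElem? h
  | cst _ hτ _ _ => exact hτ

theorem IsFm.mono {K : Calc} {ν ν' : Ordinal.{u}} (hν : ν ≤ ν') : ∀ {c : Fm.{u}}
    {Γ : List Ty.{u}}, IsFm lam K ν Γ c → IsFm lam K ν' Γ c
  | _, _, .bot hK => .bot hK
  | _, _, .top hK => .top hK
  | _, _, .gt hK hs ht => .gt hK hs ht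
  | _, _, .app hμ hf hts => .app (hμ.trans hν) hf hts
  | _, _, .and ha hb => .and (ha.mono hν) (hb.mono hν)
  | _, _, .or ha hb => .or (ha.mono hν) (hb.mono hν)
  | _, _, .neg ha => .neg (ha.mono hν)
  | _, _, .all hτ h hc => .all hτ (h.trans_le hν) (hc.mono hν)
  | _, _, .ex hτ h hc => .ex hτ (h.trans_le hν) (hc.mono hν)

theorem order_ne_of_avoids {K : Calc} {ν : Ordinal.{u}} {Γ : List Ty.{u}} {t : Tm.{u}}
    {τ : Ty.{u}} (h : IsTm lam K Γ t τ) (ha : t.Avoids ν Γ) : τ.order ≠ ν := by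
  cases h with
  | fvar hτ => exact ha
  | bvar h => exact ha _ h
  | num => exact ha
  | cst => exact ha.1

mutual

theorem IsTm.avoids {K : Calc} {ν : Ordinal.{u}} {Γ : List Ty.{u}} {t : Tm.{u}} {τ : Ty.{u}}
    (hΓ : CtxWF lam Γ) : IsTm lam K Γ t τ → τ.order < ν → t.Avoids ν Γ
  | .fvar _, hν => hν.ne
  | .bvar h, hν => fun σ hσ => by
    obtain rfl : τ = σ := Option.some_injective _ (h.symm.trans hσ)
    exact hν.ne
  | .num _, hν => hν.ne
  | .cst _ hτ hc _, hν => ⟨hν.ne, hc.avoids (hΓ.append hτ) hν⟩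

theorem IsFm.avoids {K : Calc} {ν μ : Ordinal.{u}} {Γ : List Ty.{u}} {c : Fm.{u}}
    (hΓ : CtxWF lam Γ) : IsFm lam K μ Γ c → μ < ν → c.Avoids ν Γ
  | .bot _, _ => trivial
  | .top _, _ => trivial
  | .gt _ hs ht, hν =>
    ⟨hs.avoids hΓ (zero_le.trans_lt hν), ht.avoids hΓ (zero_le.trans_lt hν)⟩
  | .app hμ hf hts, hν => ⟨hf.avoids hΓ (hμ.trans_lt hν), fun j =>
      (hts j).avoids hΓ (((hf.wf_rel hΓ).arg_lt j).trans_le (hμ.trans hν.le))⟩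
  | .and ha hb, hν => ⟨ha.avoids hΓ hν, hb.avoids hΓ hν⟩
  | .or ha hb, hν => ⟨ha.avoids hΓ hν, hb.avoids hΓ hν⟩
  | .neg ha, hν => by
    have h := ha.avoids hΓ hν
    exact h
  | .all hτ h hc, hν => ⟨(h.trans hν).ne, hc.avoids (hΓ.cons hτ) hν⟩
  | .ex hτ h hc, hν => ⟨(h.trans hν).ne, hc.avoids (hΓ.cons hτ) hν⟩

end

mutual

theorem IsTm.occurs {K : Calc} {Γ : List Ty.{u}} {t : Tm.{u}} {τ σ : Ty.{u}} {i : ℕ}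
    (hΓ : CtxWF lam Γ) : IsTm lam K Γ t τ → t.Occurs σ i → σ.WF lam ∧ σ.order ≤ τ.order
  | .fvar hτ, h => by
    obtain ⟨rfl, -⟩ := h
    exact ⟨hτ, le_rfl⟩
  | .bvar _, h => h.elim
  | .num _, h => h.elim
  | .cst _ hτ hc _, h => hc.occurs (hΓ.append hτ) h

theorem IsFm.occurs {K : Calc} {ν : Ordinal.{u}} {Γ : List Ty.{u}} {c : Fm.{u}} {σ : Ty.{u}}
    {i : ℕ} (hΓ : CtxWF lam Γ) : IsFm lam K ν Γ c → c.Occurs σ i → σ.WF lam ∧ σ.order ≤ ν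
  | .bot _, h => h.elim
  | .top _, h => h.elim
  | .gt _ hs ht, h => by
    rcases h with h | h
    · exact (hs.occurs hΓ h).imp_right fun h => h.trans zero_le
    · exact (ht.occurs hΓ h).imp_right fun h => h.trans zero_le
  | .app hμ hf hts, h => by
    rcases h with h | ⟨j, h⟩
    · exact (hf.occurs hΓ h).imp_right fun h => h.trans hμ
    · exact ((hts j).occurs hΓ h).imp_right fun h =>
        h.trans (((hf.wf_rel hΓ).arg_lt j).le.trans hμ)
  | .and ha hb, h => h.elim (ha.occurs hΓ) (hb.occurs hΓ)
  | .or ha hb, h => h.elim (ha.occurs hΓ) (hb.occurs hΓ)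
  | .neg ha, h => ha.occurs hΓ h
  | .all hτ _ hc, h => hc.occurs (hΓ.cons hτ) h
  | .ex hτ _ hc, h => hc.occurs (hΓ.cons hτ) h

end

mutual

theorem Tm.Avoids.occurs {ν : Ordinal.{u}} {σ : Ty.{u}} {i : ℕ} : ∀ (t : Tm.{u})
    {Γ : List Ty.{u}}, t.Avoids ν Γ → t.Occurs σ i → σ.order ≠ ν
  | .fvar τ i, _, h, ho => by
    obtain ⟨rfl, -⟩ := ho
    exact h
  | .bvar _, _, _, ho => ho.elim
  | .num _, _, _, ho => ho.elim
  | .cst _ _ _ c, _, h, ho => Fm.Avoids.occurs c h.2 ho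

theorem Fm.Avoids.occurs {ν : Ordinal.{u}} {σ : Ty.{u}} {i : ℕ} : ∀ (c : Fm.{u})
    {Γ : List Ty.{u}}, c.Avoids ν Γ → c.Occurs σ i → σ.order ≠ ν
  | .bot, _, _, ho => ho.elim
  | .top, _, _, ho => ho.elim
  | .gt s t, _, h, ho => ho.elim (Tm.Avoids.occurs s h.1) (Tm.Avoids.occurs t h.2)
  | .app f _ ts, _, h, ho =>
    ho.elim (Tm.Avoids.occurs f h.1) fun ⟨j, hj⟩ => Tm.Avoids.occurs (ts j) (h.2 j) hj
  | .and a b, _, h, ho => ho.elim (Fm.Avoids.occurs a h.1) (Fm.Avoids.occurs b h.2)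
  | .or a b, _, h, ho => ho.elim (Fm.Avoids.occurs a h.1) (Fm.Avoids.occurs b h.2)
  | .neg a, _, h, ho => Fm.Avoids.occurs a h ho
  | .all _ c, _, h, ho => Fm.Avoids.occurs c h.2 ho
  | .ex _ c, _, h, ho => Fm.Avoids.occurs c h.2 ho

end

/-- The free variables of a constant have orders below that of its type. -/
theorem IsConst.occurs {t : Tm.{u}} {τ σ : Ty.{u}} {i : ℕ} (h : IsConst lam t τ)
    (ho : t.Occurs σ i) : σ.order < τ.order := by
  obtain ⟨h, hn⟩ := h
  cases h with
  | fvar _ => exact absurd rfl (hn _ _)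
  | bvar _ => exact ho.elim
  | num _ => exact ho.elim
  | cst hK hτ hc hν =>
    exact lt_of_le_of_ne (hc.occurs (CtxWF.nil.append hτ) ho).2 (hν.occurs _ ho)

/-! Renaming of indices along a map that preserves their types. -/

theorem getElem?_upRen {Γ Γ' : List Ty.{u}} {ρ : ℕ → ℕ} (h : ∀ k, Γ'[ρ k]? = Γ[k]?)
    (Δ : List Ty.{u}) (k : ℕ) : (Δ ++ Γ')[upRen Δ.length ρ k]? = (Δ ++ Γ)[k]? := by
  by_cases hk : k < Δ.length
  · simp only [upRen, hk, if_true, List.getElem?_append_left hk]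
  · simp only [upRen, hk, if_false]
    rw [List.getElem?_append_right (by omega), List.getElem?_append_right (by omega)]
    simpa using h _

mutual

theorem Tm.Avoids.rename {ν : Ordinal.{u}} : ∀ (t : Tm.{u}) {Γ Γ' : List Ty.{u}} {ρ : ℕ → ℕ},
    (∀ k, Γ'[ρ k]? = Γ[k]?) → t.Avoids ν Γ → (t.rename ρ).Avoids ν Γ'
  | .fvar _ _, _, _, _, _, h => h
  | .bvar k, _, _, _, hρ, h => fun τ hτ => h τ ((hρ k).symm.trans hτ)
  | .num _, _, _, _, _, h => h
  | .cst _ _ τs c, _, _, _, hρ, h =>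
    ⟨h.1, Fm.Avoids.rename c (by simpa only [length_ctx] using getElem?_upRen hρ (ctx τs)) h.2⟩

theorem Fm.Avoids.rename {ν : Ordinal.{u}} : ∀ (c : Fm.{u}) {Γ Γ' : List Ty.{u}} {ρ : ℕ → ℕ},
    (∀ k, Γ'[ρ k]? = Γ[k]?) → c.Avoids ν Γ → (c.rename ρ).Avoids ν Γ'
  | .bot, _, _, _, _, _ => trivial
  | .top, _, _, _, _, _ => trivial
  | .gt s t, _, _, _, hρ, h => ⟨Tm.Avoids.rename s hρ h.1, Tm.Avoids.rename t hρ h.2⟩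
  | .app f _ ts, _, _, _, hρ, h =>
    ⟨Tm.Avoids.rename f hρ h.1, fun j => Tm.Avoids.rename (ts j) hρ (h.2 j)⟩
  | .and a b, _, _, _, hρ, h => ⟨Fm.Avoids.rename a hρ h.1, Fm.Avoids.rename b hρ h.2⟩
  | .or a b, _, _, _, hρ, h => ⟨Fm.Avoids.rename a hρ h.1, Fm.Avoids.rename b hρ h.2⟩
  | .neg a, _, _, _, hρ, h => Fm.Avoids.rename a hρ h
  | .all τ c, _, _, _, hρ, h => ⟨h.1, Fm.Avoids.rename c (getElem?_upRen hρ [τ]) h.2⟩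
  | .ex τ c, _, _, _, hρ, h => ⟨h.1, Fm.Avoids.rename c (getElem?_upRen hρ [τ]) h.2⟩

end

mutual

theorem IsTm.rename {K : Calc} {Γ Γ' : List Ty.{u}} {ρ : ℕ → ℕ} (hρ : ∀ k, Γ'[ρ k]? = Γ[k]?)
    {t : Tm.{u}} {τ : Ty.{u}} : IsTm lam K Γ t τ → IsTm lam K Γ' (t.rename ρ) τ
  | .fvar hτ => .fvar hτ
  | .bvar h => .bvar ((hρ _).trans h)
  | .num hK => .num hK
  | .cst (τs := τs) hK hτ hc hν => by
    have hρ' := getElem?_upRen hρ (ctx τs)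
    rw [length_ctx] at hρ'
    exact .cst hK hτ (hc.rename hρ') (hν.rename _ hρ')

theorem IsFm.rename {K : Calc} {ν : Ordinal.{u}} {Γ Γ' : List Ty.{u}} {ρ : ℕ → ℕ}
    (hρ : ∀ k, Γ'[ρ k]? = Γ[k]?) {c : Fm.{u}} : IsFm lam K ν Γ c → IsFm lam K ν Γ' (c.rename ρ)
  | .bot hK => .bot hK
  | .top hK => .top hK
  | .gt hK hs ht => .gt hK (hs.rename hρ) (ht.rename hρ)
  | .app hμ hf hts => .app hμ (hf.rename hρ) fun j => (hts j).rename hρ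
  | .and ha hb => .and (ha.rename hρ) (hb.rename hρ)
  | .or ha hb => .or (ha.rename hρ) (hb.rename hρ)
  | .neg ha => .neg (ha.rename hρ)
  | .all (τ := τ) hτ h hc => .all hτ h (hc.rename (getElem?_upRen hρ [τ]))
  | .ex (τ := τ) hτ h hc => .ex hτ h (hc.rename (getElem?_upRen hρ [τ]))

end

theorem IsTm.shift {K : Calc} {Γ : List Ty.{u}} {t : Tm.{u}} {τ : Ty.{u}}
    (h : IsTm lam K Γ t τ) (Δ : List Ty.{u}) :
    IsTm lam K (Δ ++ Γ) (t.rename (fun k => k + Δ.length)) τ :=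
  h.rename fun k => by rw [List.getElem?_append_right (by omega)]; simp

/-- `θ` and `σ` substitute terms of the right types, in the context `Γ'`, for the free variables and
for the indices of the types `Γ`. -/
structure IsSubst (lam : Ordinal.{u}) (Γ Γ' : List Ty.{u}) (θ : Ty.{u} → ℕ → Tm.{u})
    (σ : ℕ → Tm.{u}) : Prop where
  free : ∀ τ i, τ.WF lam → IsTm lam .ind Γ' (θ τ i) τ
  bound : ∀ k τ, Γ[k]? = some τ → IsTm lam .ind Γ' (σ k) τ

theorem IsSubst.up {Γ Γ' : List Ty.{u}} {θ : Ty.{u} → ℕ → Tm.{u}} {σ : ℕ → Tm.{u}}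
    (h : IsSubst lam Γ Γ' θ σ) (Δ : List Ty.{u}) :
    IsSubst lam (Δ ++ Γ) (Δ ++ Γ') (upFree Δ.length θ) (upBound Δ.length σ) where
  free τ i hτ := (h.free τ i hτ).shift Δ
  bound k τ hk := by
    by_cases hn : k < Δ.length
    · simp only [upBound, hn, if_true]
      rw [List.getElem?_append_left hn] at hk
      exact .bvar (by rwa [List.getElem?_append_left hn])
    · simp only [upBound, hn, if_false]
      rw [List.getElem?_append_right (by omega)] at hk
      exact (h.bound _ _ hk).shift Δ

theorem IsSubst.up_ctx {Γ Γ' : List Ty.{u}} {θ : Ty.{u} → ℕ → Tm.{u}} {σ : ℕ → Tm.{u}}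
    (h : IsSubst lam Γ Γ' θ σ) {n : ℕ} (τs : Fin n → Ty.{u}) :
    IsSubst lam (ctx τs ++ Γ) (ctx τs ++ Γ') (upFree n θ) (upBound n σ) := by
  simpa only [length_ctx] using h.up (ctx τs)

mutual

theorem IsTm.subst {Γ Γ' : List Ty.{u}} {θ : Ty.{u} → ℕ → Tm.{u}} {σ : ℕ → Tm.{u}}
    (hΓ : CtxWF lam Γ) (hΓ' : CtxWF lam Γ') (hs : IsSubst lam Γ Γ' θ σ) {t : Tm.{u}} {τ : Ty.{u}} :
    IsTm lam .ind Γ t τ → IsTm lam .ind Γ' (t.subst θ σ) τ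
  | .fvar hτ => hs.free _ _ hτ
  | .bvar h => hs.bound _ _ h
  | .num hK => .num hK
  | .cst hK hτ hc hν =>
    have h := hc.subst_avoids (hΓ.append hτ) (hΓ'.append hτ) (hs.up_ctx _)
    .cst hK hτ h.1 (h.2 _ le_rfl hν)

theorem IsFm.subst_avoids {ν : Ordinal.{u}} {Γ Γ' : List Ty.{u}} {θ : Ty.{u} → ℕ → Tm.{u}}
    {σ : ℕ → Tm.{u}} (hΓ : CtxWF lam Γ) (hΓ' : CtxWF lam Γ') (hs : IsSubst lam Γ Γ' θ σ)
    {c : Fm.{u}} : IsFm lam .ind ν Γ c → IsFm lam .ind ν Γ' (c.subst θ σ) ∧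
      ∀ μ, ν ≤ μ → c.Avoids μ Γ → (c.subst θ σ).Avoids μ Γ'
  | .bot hK => ⟨.bot hK, fun _ _ _ => trivial⟩
  | .top hK => ⟨.top hK, fun _ _ _ => trivial⟩
  | .gt hK hs' ht => by
    have h1 := hs'.subst hΓ hΓ' hs
    have h2 := ht.subst hΓ hΓ' hs
    refine ⟨.gt hK h1 h2, fun μ _ ha => ?_⟩
    have h3 := pos_iff_ne_zero.2 (order_ne_of_avoids hs' ha.1).symm
    exact ⟨h1.avoids hΓ' h3, h2.avoids hΓ' h3⟩
  | .app hμ hf hts => by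
    have h1 := hf.subst hΓ hΓ' hs
    have h2 := fun j => (hts j).subst hΓ hΓ' hs
    refine ⟨.app hμ h1 h2, fun μ' hμ' ha => ?_⟩
    have h3 := lt_of_le_of_ne (hμ.trans hμ') (order_ne_of_avoids hf ha.1)
    exact ⟨h1.avoids hΓ' h3, fun j => (h2 j).avoids hΓ' (((hf.wf_rel hΓ).arg_lt j).trans h3)⟩
  | .and ha hb =>
    have h1 := ha.subst_avoids hΓ hΓ' hs
    have h2 := hb.subst_avoids hΓ hΓ' hs
    ⟨.and h1.1 h2.1, fun μ hμ h => ⟨h1.2 μ hμ h.1, h2.2 μ hμ h.2⟩⟩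
  | .or ha hb =>
    have h1 := ha.subst_avoids hΓ hΓ' hs
    have h2 := hb.subst_avoids hΓ hΓ' hs
    ⟨.or h1.1 h2.1, fun μ hμ h => ⟨h1.2 μ hμ h.1, h2.2 μ hμ h.2⟩⟩
  | .neg ha =>
    have h1 := ha.subst_avoids hΓ hΓ' hs
    ⟨.neg h1.1, fun μ hμ h => h1.2 μ hμ h⟩
  | .all (τ := τ) hτ h hc =>
    have h1 := hc.subst_avoids (hΓ.cons hτ) (hΓ'.cons hτ) (hs.up [τ])
    ⟨.all hτ h h1.1, fun μ hμ h => ⟨h.1, h1.2 μ hμ h.2⟩⟩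
  | .ex (τ := τ) hτ h hc =>
    have h1 := hc.subst_avoids (hΓ.cons hτ) (hΓ'.cons hτ) (hs.up [τ])
    ⟨.ex hτ h h1.1, fun μ hμ h => ⟨h.1, h1.2 μ hμ h.2⟩⟩

end

theorem IsFm.subst {ν : Ordinal.{u}} {Γ Γ' : List Ty.{u}} {θ : Ty.{u} → ℕ → Tm.{u}}
    {σ : ℕ → Tm.{u}} (hΓ : CtxWF lam Γ) (hΓ' : CtxWF lam Γ') (hs : IsSubst lam Γ Γ' θ σ)
    {c : Fm.{u}} (h : IsFm lam .ind ν Γ c) : IsFm lam .ind ν Γ' (c.subst θ σ) :=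
  (h.subst_avoids hΓ hΓ' hs).1

theorem IsSubst.consN {Γ Γ' : List Ty.{u}} {θ : Ty.{u} → ℕ → Tm.{u}} {σ : ℕ → Tm.{u}}
    (h : IsSubst lam Γ Γ' θ σ) {n : ℕ} {τs : Fin n → Ty.{u}} {ts : Fin n → Tm.{u}}
    (hts : ∀ j, IsTm lam .ind Γ' (ts j) (τs j)) :
    IsSubst lam (ctx τs ++ Γ) Γ' θ (consN n ts σ) where
  free := h.free
  bound k τ hk := by
    by_cases hn : k < n
    · rw [List.getElem?_append_left (by rwa [length_ctx]),
        List.getElem?_eq_getElem (by rwa [length_ctx])] at hk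
      obtain rfl := Option.some_injective _ hk
      simpa [Ramified.consN, hn, Ramified.ctx] using hts _
    · rw [List.getElem?_append_right (by rw [length_ctx]; omega), length_ctx] at hk
      simpa only [Ramified.consN, hn, dite_false] using h.bound _ _ hk

theorem IsSubst.refl {Γ : List Ty.{u}} : IsSubst lam Γ Γ Tm.fvar Tm.bvar where
  free _ _ hτ := .fvar hτ
  bound _ _ hk := .bvar hk

theorem IsFm.inst {ν : Ordinal.{u}} {Γ : List Ty.{u}} {n : ℕ} {τs : Fin n → Ty.{u}}
    {ts : Fin n → Tm.{u}} {c : Fm.{u}} (hΓ : CtxWF lam Γ) (hτ : ∀ j, (τs j).WF lam)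
    (hts : ∀ j, IsTm lam .ind Γ (ts j) (τs j)) (h : IsFm lam .ind ν (ctx τs ++ Γ) c) :
    IsFm lam .ind ν Γ (c.inst n ts) ∧
      ∀ μ, ν ≤ μ → c.Avoids μ (ctx τs ++ Γ) → (c.inst n ts).Avoids μ Γ :=
  h.subst_avoids (fun τ h => (List.mem_append.1 h).elim
    (fun h => by obtain ⟨j, rfl⟩ := mem_ctx.1 h; exact hτ j) (hΓ τ)) hΓ (IsSubst.refl.consN hts)

mutual

/-- A substitution into a term depends only on the values at the free variables that occur in it and
at the indices in its context. -/
theorem IsTm.subst_congr {K : Calc} {Γ : List Ty.{u}} {θ θ' : Ty.{u} → ℕ → Tm.{u}}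
    {σ σ' : ℕ → Tm.{u}} {t : Tm.{u}} {τ : Ty.{u}} (hσ : ∀ k < Γ.length, σ k = σ' k) :
    IsTm lam K Γ t τ → (∀ τ i, t.Occurs τ i → θ τ i = θ' τ i) → t.subst θ σ = t.subst θ' σ'
  | .fvar _, hθ => hθ _ _ ⟨rfl, rfl⟩
  | .bvar h, _ => hσ _ (List.getElem?_eq_some_iff.1 h).1
  | .num _, _ => rfl
  | .cst (n := n) (τs := τs) _ _ hc _, hθ => by
    simp only [Tm.subst]
    rw [hc.subst_congr (σ' := upBound n σ') (θ' := upFree n θ') ?_ (fun τ i h => by simp only [upFree, hθ τ i h])]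
    intro k hk
    rw [List.length_append, length_ctx] at hk
    by_cases hn : k < n
    · simp [upBound, hn]
    · simp only [upBound, hn, if_false, hσ (k - n) (by omega)]

theorem IsFm.subst_congr {K : Calc} {ν : Ordinal.{u}} {Γ : List Ty.{u}}
    {θ θ' : Ty.{u} → ℕ → Tm.{u}} {σ σ' : ℕ → Tm.{u}} {c : Fm.{u}}
    (hσ : ∀ k < Γ.length, σ k = σ' k) :
    IsFm lam K ν Γ c → (∀ τ i, c.Occurs τ i → θ τ i = θ' τ i) → c.subst θ σ = c.subst θ' σ'
  | .bot _, _ => rfl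
  | .top _, _ => rfl
  | .gt _ hs ht, hθ => by
    simp only [Fm.subst]
    rw [hs.subst_congr hσ fun τ i h => hθ τ i (.inl h), ht.subst_congr hσ fun τ i h => hθ τ i (.inr h)]
  | .app _ hf hts, hθ => by
    simp only [Fm.subst]
    rw [hf.subst_congr hσ fun τ i h => hθ τ i (.inl h)]
    congr 1
    funext j
    exact (hts j).subst_congr hσ fun τ i h => hθ τ i (.inr ⟨j, h⟩)
  | .and ha hb, hθ => by
    simp only [Fm.subst]
    rw [ha.subst_congr hσ fun τ i h => hθ τ i (.inl h), hb.subst_congr hσ fun τ i h => hθ τ i (.inr h)]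
  | .or ha hb, hθ => by
    simp only [Fm.subst]
    rw [ha.subst_congr hσ fun τ i h => hθ τ i (.inl h), hb.subst_congr hσ fun τ i h => hθ τ i (.inr h)]
  | .neg ha, hθ => by
    simp only [Fm.subst]
    rw [ha.subst_congr hσ hθ]
  | .all _ _ hc, hθ => by
    simp only [Fm.subst]
    rw [hc.subst_congr (σ' := upBound 1 σ') (θ' := upFree 1 θ') ?_ (fun τ i h => by simp only [upFree, hθ τ i h])]
    intro k hk
    rw [List.length_cons] at hk
    by_cases hn : k < 1
    · simp [upBound, hn]
    · simp only [upBound, hn, if_false, hσ (k - 1) (by omega)]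
  | .ex _ _ hc, hθ => by
    simp only [Fm.subst]
    rw [hc.subst_congr (σ' := upBound 1 σ') (θ' := upFree 1 θ') ?_ (fun τ i h => by simp only [upFree, hθ τ i h])]
    intro k hk
    rw [List.length_cons] at hk
    by_cases hn : k < 1
    · simp [upBound, hn]
    · simp only [upBound, hn, if_false, hσ (k - 1) (by omega)]

end

theorem ctx_succ {n : ℕ} (τs : Fin (n + 1) → Ty.{u}) :
    ctx τs = ctx (fun j => τs j.succ) ++ [τs 0] := by
  simp only [ctx, List.ofFn_succ', List.concat_eq_append, Fin.rev_castSucc, Fin.rev_last]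

theorem IsFm.alls {K : Calc} {ν : Ordinal.{u}} {c : Fm.{u}} : ∀ {n : ℕ} {τs : Fin n → Ty.{u}}
    {Γ : List Ty.{u}}, (∀ j, (τs j).WF lam) → (∀ j, (τs j).order < ν) →
      IsFm lam K ν (ctx τs ++ Γ) c → IsFm lam K ν Γ (alls n τs c)
  | 0, _, _, _, _, hc => by simpa [ctx, Ramified.alls] using hc
  | n + 1, τs, Γ, hτ, hν, hc => by
    rw [ctx_succ, List.append_assoc] at hc
    exact .all (hτ 0) (hν 0) (IsFm.alls (fun j => hτ j.succ) (fun j => hν j.succ) hc)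

/-! ### Closed constants -/

/-- No free variable occurs in `t`. -/
def NoFree (t : Tm.{u}) : Prop := ∀ τ i, ¬ t.Occurs τ i

/-- `t` is a constant of type `τ` without free variables. -/
def IsClosed (lam : Ordinal.{u}) (t : Tm.{u}) (τ : Ty.{u}) : Prop :=
  IsTm lam .ind [] t τ ∧ NoFree t

theorem IsClosed.isConst {t : Tm.{u}} {τ : Ty.{u}} (h : IsClosed lam t τ) : IsConst lam t τ :=
  ⟨h.1, fun σ i e => h.2 σ i (e ▸ ⟨rfl, rfl⟩)⟩

theorem IsConst.exists_cst {t : Tm.{u}} {ν : Ordinal.{u}} {n : ℕ} {τs : Fin n → Ty.{u}}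
    (h : IsConst lam t (.rel ν n τs)) : ∃ c, t = .cst ν n τs c ∧ (Ty.rel ν n τs).WF lam ∧
      IsFm lam .ind ν (ctx τs) c ∧ c.Avoids ν (ctx τs) := by
  obtain ⟨h, hn⟩ := h
  cases h with
  | fvar _ => exact absurd rfl (hn _ _)
  | bvar h => simp at h
  | cst hK hτ hc hν => exact ⟨_, rfl, hτ, by simpa using hc, by simpa using hν⟩

theorem IsConst.exists_num {t : Tm.{u}} (h : IsConst lam t .ind) : ∃ k, t = .num k := by
  obtain ⟨h, hn⟩ := h
  cases h with
  | fvar _ => exact absurd rfl (hn _ _)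
  | bvar h => simp at h
  | num _ => exact ⟨_, rfl⟩

/-- `θ` and `σ` substitute closed constants of the right types. -/
structure IsEnv (lam : Ordinal.{u}) (Γ : List Ty.{u}) (θ : Ty.{u} → ℕ → Tm.{u})
    (σ : ℕ → Tm.{u}) : Prop extends IsSubst lam Γ [] θ σ where
  noFree_free : ∀ τ i, NoFree (θ τ i)
  noFree_bound : ∀ k, NoFree (σ k)

theorem IsEnv.noFree {Γ : List Ty.{u}} {θ : Ty.{u} → ℕ → Tm.{u}} {σ : ℕ → Tm.{u}}
    (h : IsEnv lam Γ θ σ) (t : Tm.{u}) : NoFree (t.subst θ σ) := by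
  intro τ i ho
  rcases t.occurs_subst ho with ⟨_, _, _, h'⟩ | ⟨_, h'⟩
  exacts [h.noFree_free _ _ _ _ h', h.noFree_bound _ _ _ h']

theorem IsEnv.not_occurs {Γ : List Ty.{u}} {θ : Ty.{u} → ℕ → Tm.{u}} {σ : ℕ → Tm.{u}}
    (h : IsEnv lam Γ θ σ) (c : Fm.{u}) (τ : Ty.{u}) (i : ℕ) : ¬ (c.subst θ σ).Occurs τ i := by
  intro ho
  rcases c.occurs_subst ho with ⟨_, _, _, h'⟩ | ⟨_, h'⟩
  exacts [h.noFree_free _ _ _ _ h', h.noFree_bound _ _ _ h']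

theorem IsEnv.isClosed {Γ : List Ty.{u}} {θ : Ty.{u} → ℕ → Tm.{u}} {σ : ℕ → Tm.{u}}
    (h : IsEnv lam Γ θ σ) (hΓ : CtxWF lam Γ) {t : Tm.{u}} {τ : Ty.{u}}
    (ht : IsTm lam .ind Γ t τ) : IsClosed lam (t.subst θ σ) τ :=
  ⟨ht.subst hΓ CtxWF.nil h.toIsSubst, h.noFree t⟩

theorem IsEnv.consN {Γ : List Ty.{u}} {θ : Ty.{u} → ℕ → Tm.{u}} {σ : ℕ → Tm.{u}}
    (h : IsEnv lam Γ θ σ) {n : ℕ} {τs : Fin n → Ty.{u}} {ts : Fin n → Tm.{u}}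
    (hts : ∀ j, IsClosed lam (ts j) (τs j)) : IsEnv lam (ctx τs ++ Γ) θ (consN n ts σ) where
  toIsSubst := h.toIsSubst.consN fun j => (hts j).1
  noFree_free := h.noFree_free
  noFree_bound k := by
    unfold Ramified.consN
    split
    · exact (hts _).2
    · exact h.noFree_bound _

theorem IsEnv.cons {Γ : List Ty.{u}} {θ : Ty.{u} → ℕ → Tm.{u}} {σ : ℕ → Tm.{u}}
    (h : IsEnv lam Γ θ σ) {τ : Ty.{u}} {t : Tm.{u}} (ht : IsClosed lam t τ) :
    IsEnv lam (τ :: Γ) θ (Ramified.consN 1 (fun _ => t) σ) :=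
  h.consN (n := 1) (τs := fun _ => τ) fun _ => ht

theorem exists_isClosed {τ : Ty.{u}} (h : τ.WF lam) : ∃ t, IsClosed lam t τ := by
  cases τ with
  | ind => exact ⟨.num 0, .num rfl, fun _ _ h => h⟩
  | rel ν n τs =>
    exact ⟨.cst ν n τs (.gt (.num 0) (.num 0)),
      .cst rfl h (.gt rfl (.num rfl) (.num rfl)) ⟨h.pos.ne, h.pos.ne⟩, fun _ _ h => h.elim id id⟩

theorem exists_isEnv (lam : Ordinal.{u}) : ∃ θ, IsEnv lam [] θ Tm.bvar := by
  classical
  refine ⟨fun τ _ => if h : τ.WF lam then (exists_isClosed h).choose else .num 0,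
    ⟨⟨fun τ i hτ => ?_, fun k τ h => by simp at h⟩, fun τ i => ?_, fun _ _ _ h => h⟩⟩
  · simpa only [hτ, dite_true] using (exists_isClosed hτ).choose_spec.1
  · split
    · exact (Exists.choose_spec (p := fun t => IsClosed lam t τ) _).2
    · exact fun _ _ h => h

/-! ### Ranks -/

/-- The order of the type of a term, `Γ` being the list of the types of the indices. -/
def headOrder (Γ : List Ty.{u}) : Tm.{u} → Ordinal.{u}
  | .fvar τ _ => τ.order
  | .bvar k => (Γ[k]?.map Ty.order).getD 0
  | .num _ => 0
  | .cst ν _ _ _ => ν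

/-- The rank of a formula: `ω * μ` for a prime formula beginning with a term of order `μ`. -/
noncomputable def rank : List Ty.{u} → Fm.{u} → Ordinal.{u}
  | _, .bot => 0
  | _, .top => 0
  | _, .gt _ _ => 0
  | Γ, .app f _ _ => Ordinal.omega0 * headOrder Γ f
  | Γ, .and a b => max (rank Γ a) (rank Γ b) + 1
  | Γ, .or a b => max (rank Γ a) (rank Γ b) + 1
  | Γ, .neg a => rank Γ a + 1
  | Γ, .all τ c => rank (τ :: Γ) c + 1
  | Γ, .ex τ c => rank (τ :: Γ) c + 1

theorem IsTm.headOrder_eq {K : Calc} {Γ : List Ty.{u}} {t : Tm.{u}} {τ : Ty.{u}}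
    (h : IsTm lam K Γ t τ) : headOrder Γ t = τ.order := by
  cases h with
  | fvar => rfl
  | bvar h => simp [headOrder, h]
  | num => rfl
  | cst => rfl

theorem headOrder_shift (Δ Γ : List Ty.{u}) (t : Tm.{u}) :
    headOrder (Δ ++ Γ) (t.rename (fun k => k + Δ.length)) = headOrder Γ t := by
  cases t with
  | bvar k => simp [headOrder, Tm.rename, List.getElem?_append_right]
  | _ => rfl

/-- `θ` and `σ` substitute terms of the same order. -/
def KeepsOrder (Γ Γ' : List Ty.{u}) (θ : Ty.{u} → ℕ → Tm.{u}) (σ : ℕ → Tm.{u}) : Prop :=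
  (∀ τ i, headOrder Γ' (θ τ i) = τ.order) ∧ ∀ k, headOrder Γ' (σ k) = headOrder Γ (.bvar k)

theorem KeepsOrder.up {Γ Γ' : List Ty.{u}} {θ : Ty.{u} → ℕ → Tm.{u}} {σ : ℕ → Tm.{u}}
    (h : KeepsOrder Γ Γ' θ σ) (τ : Ty.{u}) :
    KeepsOrder (τ :: Γ) (τ :: Γ') (upFree 1 θ) (upBound 1 σ) := by
  refine ⟨fun σ' i => (headOrder_shift [τ] Γ' _).trans (h.1 σ' i), fun k => ?_⟩
  cases k with
  | zero => rfl
  | succ k => exact (headOrder_shift [τ] Γ' _).trans (by simpa [headOrder] using h.2 k)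

theorem KeepsOrder.headOrder {Γ Γ' : List Ty.{u}} {θ : Ty.{u} → ℕ → Tm.{u}} {σ : ℕ → Tm.{u}}
    (h : KeepsOrder Γ Γ' θ σ) (t : Tm.{u}) : headOrder Γ' (t.subst θ σ) = headOrder Γ t := by
  cases t with
  | fvar τ i => exact h.1 τ i
  | bvar k => exact h.2 k
  | num => rfl
  | cst => rfl

theorem KeepsOrder.rank : ∀ {Γ Γ' : List Ty.{u}}
    {θ : Ty.{u} → ℕ → Tm.{u}} {σ : ℕ → Tm.{u}} (c : Fm.{u}), KeepsOrder Γ Γ' θ σ →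
      rank Γ' (c.subst θ σ) = rank Γ c
  | _, _, _, _, .bot, _ => rfl
  | _, _, _, _, .top, _ => rfl
  | _, _, _, _, .gt _ _, _ => rfl
  | _, _, _, _, .app f _ _, h => by simp only [Ramified.rank, Fm.subst, h.headOrder f]
  | _, _, _, _, .and a b, h => by
    simp only [Ramified.rank, Fm.subst, KeepsOrder.rank a h, KeepsOrder.rank b h]
  | _, _, _, _, .or a b, h => by
    simp only [Ramified.rank, Fm.subst, KeepsOrder.rank a h, KeepsOrder.rank b h]
  | _, _, _, _, .neg a, h => by simp only [Ramified.rank, Fm.subst, KeepsOrder.rank a h]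
  | _, _, _, _, .all τ c, h => by
    simp only [Ramified.rank, Fm.subst, KeepsOrder.rank c (h.up τ)]
  | _, _, _, _, .ex τ c, h => by
    simp only [Ramified.rank, Fm.subst, KeepsOrder.rank c (h.up τ)]

theorem keepsOrder_inst {Γ : List Ty.{u}} {n : ℕ} {τs : Fin n → Ty.{u}} {ts : Fin n → Tm.{u}}
    (h : ∀ j, headOrder Γ (ts j) = (τs j).order) :
    KeepsOrder (ctx τs ++ Γ) Γ Tm.fvar (consN n ts Tm.bvar) := by
  refine ⟨fun _ _ => rfl, fun k => ?_⟩
  by_cases hk : k < n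
  · have h1 : k < (ctx τs).length := by rwa [length_ctx]
    simp only [consN, hk, dite_true, h]
    simp only [headOrder, List.getElem?_append_left h1, List.getElem?_eq_getElem h1]
    simp [ctx]
  · have h1 : (ctx τs).length ≤ k := by rw [length_ctx]; omega
    simp only [consN, hk, dite_false, headOrder, List.getElem?_append_right h1, length_ctx]

theorem rank_inst1 {τ : Ty.{u}} {t : Tm.{u}} (c : Fm.{u}) (h : IsClosed lam t τ) :
    rank [] (c.inst1 t) = rank [τ] c :=
  KeepsOrder.rank c
    (keepsOrder_inst (n := 1) (τs := fun _ => τ) fun _ => h.1.headOrder_eq)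

theorem add_one_lt_omega0_mul {ν x : Ordinal.{u}} (h : x < Ordinal.omega0 * ν) :
    x + 1 < Ordinal.omega0 * ν := by
  have hν : ν ≠ 0 := by rintro rfl; simp at h
  exact (Ordinal.isSuccLimit_mul_left Ordinal.isSuccLimit_omega0 (pos_iff_ne_zero.2 hν)).succ_lt h

theorem IsFm.rank_lt {K : Calc} {ν : Ordinal.{u}} (hν : 0 < ν) : ∀ {Γ : List Ty.{u}} {c : Fm.{u}},
    IsFm lam K ν Γ c → c.Avoids ν Γ → rank Γ c < Ordinal.omega0 * ν
  | _, _, .bot _, _ => mul_pos Ordinal.omega0_pos hν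
  | _, _, .top _, _ => mul_pos Ordinal.omega0_pos hν
  | _, _, .gt _ _ _, _ => mul_pos Ordinal.omega0_pos hν
  | _, _, .app hμ hf _, h => by
    rw [rank, hf.headOrder_eq]
    exact mul_lt_mul_of_pos_left (lt_of_le_of_ne hμ (order_ne_of_avoids hf h.1)) Ordinal.omega0_pos
  | _, _, .and ha hb, h =>
    add_one_lt_omega0_mul (max_lt (IsFm.rank_lt hν ha h.1) (IsFm.rank_lt hν hb h.2))
  | _, _, .or ha hb, h =>
    add_one_lt_omega0_mul (max_lt (IsFm.rank_lt hν ha h.1) (IsFm.rank_lt hν hb h.2))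
  | _, _, .neg ha, h => add_one_lt_omega0_mul (IsFm.rank_lt hν ha h)
  | _, _, .all _ _ hc, h => add_one_lt_omega0_mul (IsFm.rank_lt hν hc h.2)
  | _, _, .ex _ _ hc, h => add_one_lt_omega0_mul (IsFm.rank_lt hν hc h.2)

/-! ### Truth -/

/-- The truth of formulas without free variables, where variables range over closed constants. -/
def Truth (lam : Ordinal.{u}) : Fm.{u} → Prop
  | .bot => False
  | .top => True
  | .gt s t => ∃ k l, s = .num k ∧ t = .num l ∧ k > l
  | .app f n ts => ∃ ν m τs body, ∃ _ : f = .cst ν m τs body,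
      ∃ _ : rank [] (body.inst n ts) < Ordinal.omega0 * ν, Truth lam (body.inst n ts)
  | .and a b => Truth lam a ∧ Truth lam b
  | .or a b => Truth lam a ∨ Truth lam b
  | .neg a => ¬ Truth lam a
  | .all τ c => ∀ t, IsClosed lam t τ → Truth lam (c.inst1 t)
  | .ex τ c => ∃ t, ∃ _ : IsClosed lam t τ, Truth lam (c.inst1 t)
termination_by c => rank [] c
decreasing_by
  · subst f; assumption
  · exact (le_max_left _ _).trans_lt (lt_add_one _)
  · exact (le_max_right _ _).trans_lt (lt_add_one _)
  · exact (le_max_left _ _).trans_lt (lt_add_one _)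
  · exact (le_max_right _ _).trans_lt (lt_add_one _)
  · exact lt_add_one _
  · rw [rank_inst1 c ‹_›]; exact lt_add_one _
  · rw [rank_inst1 c ‹_›]; exact lt_add_one _

@[simp] theorem truth_and {a b : Fm.{u}} :
    Truth lam (.and a b) ↔ Truth lam a ∧ Truth lam b := by rw [Truth]

@[simp] theorem truth_or {a b : Fm.{u}} :
    Truth lam (.or a b) ↔ Truth lam a ∨ Truth lam b := by rw [Truth]

@[simp] theorem truth_neg {a : Fm.{u}} : Truth lam (.neg a) ↔ ¬ Truth lam a := by rw [Truth]

theorem truth_all {τ : Ty.{u}} {c : Fm.{u}} :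
    Truth lam (.all τ c) ↔ ∀ t, IsClosed lam t τ → Truth lam (c.inst1 t) := by rw [Truth]

theorem truth_ex {τ : Ty.{u}} {c : Fm.{u}} :
    Truth lam (.ex τ c) ↔ ∃ t, IsClosed lam t τ ∧ Truth lam (c.inst1 t) := by
  rw [Truth]; simp only [exists_prop]

theorem truth_gt {k l : ℕ} : Truth lam (.gt (.num k) (.num l)) ↔ k > l := by
  rw [Truth]
  constructor
  · rintro ⟨_, _, h1, h2, h⟩
    cases h1; cases h2
    exact h
  · exact fun h => ⟨k, l, rfl, rfl, h⟩

theorem rank_inst_lt {ν : Ordinal.{u}} {n : ℕ} {τs : Fin n → Ty.{u}} {c : Fm.{u}}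
    {ts : Fin n → Tm.{u}} (hf : IsConst lam (.cst ν n τs c) (.rel ν n τs))
    (hts : ∀ j, IsTm lam .ind [] (ts j) (τs j)) :
    rank [] (c.inst n ts) < Ordinal.omega0 * ν := by
  obtain ⟨_, h, hτ, hc, hν⟩ := hf.exists_cst
  cases h
  have : KeepsOrder (ctx τs ++ []) [] Tm.fvar (consN n ts Tm.bvar) :=
    keepsOrder_inst fun j => (hts j).headOrder_eq
  rw [List.append_nil] at this
  rw [Fm.inst_eq, KeepsOrder.rank c this]
  exact hc.rank_lt hτ.pos hν

theorem truth_app {ν : Ordinal.{u}} {n : ℕ} {τs : Fin n → Ty.{u}} {c : Fm.{u}}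
    {ts : Fin n → Tm.{u}} (hf : IsConst lam (.cst ν n τs c) (.rel ν n τs))
    (hts : ∀ j, IsTm lam .ind [] (ts j) (τs j)) :
    Truth lam (.app (.cst ν n τs c) n ts) ↔ Truth lam (c.inst n ts) := by
  rw [Truth]
  constructor
  · rintro ⟨_, _, _, _, h1, _, h⟩
    cases h1
    exact h
  · exact fun h => ⟨_, _, _, _, rfl, rank_inst_lt hf hts, h⟩

theorem truth_subst_all {τ : Ty.{u}} {c : Fm.{u}} {θ : Ty.{u} → ℕ → Tm.{u}} {σ : ℕ → Tm.{u}} :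
    Truth lam ((Fm.all τ c).subst θ σ) ↔
      ∀ t, IsClosed lam t τ → Truth lam (c.subst θ (consN 1 (fun _ => t) σ)) := by
  simp only [Fm.subst, truth_all, Fm.inst1, Fm.inst_subst]

theorem truth_subst_ex {τ : Ty.{u}} {c : Fm.{u}} {θ : Ty.{u} → ℕ → Tm.{u}} {σ : ℕ → Tm.{u}} :
    Truth lam ((Fm.ex τ c).subst θ σ) ↔
      ∃ t, IsClosed lam t τ ∧ Truth lam (c.subst θ (consN 1 (fun _ => t) σ)) := by
  simp only [Fm.subst, truth_ex, Fm.inst1, Fm.inst_subst]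

theorem truth_subst_alls {c : Fm.{u}} {θ : Ty.{u} → ℕ → Tm.{u}} : ∀ {n : ℕ}
    {τs : Fin n → Ty.{u}} {σ : ℕ → Tm.{u}}, Truth lam ((alls n τs c).subst θ σ) ↔
      ∀ ts : Fin n → Tm.{u}, (∀ j, IsClosed lam (ts j) (τs j)) →
        Truth lam (c.subst θ (consN n ts σ))
  | 0, τs, σ => by
    have : ∀ ts : Fin 0 → Tm.{u}, consN 0 ts σ = σ := fun ts => by funext k; simp [consN]
    simp [alls, this]
  | n + 1, τs, σ => by
    simp only [alls, truth_subst_all, truth_subst_alls (n := n), consN_cons]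
    constructor
    · intro h ts hts
      have := h (ts 0) (hts 0) (fun j => ts j.succ) fun j => hts j.succ
      rwa [← Fin.cons_self_tail ts]
    · intro h t ht ts hts
      refine h _ fun j => ?_
      refine Fin.cases ?_ (fun j => ?_) j
      exacts [ht, hts j]

/-- Truth of a prime formula beginning with an instance of `cst ν n τs c`. -/
theorem truth_subst_app {Γ : List Ty.{u}} {θ : Ty.{u} → ℕ → Tm.{u}} {σ : ℕ → Tm.{u}}
    (hΓ : CtxWF lam Γ) (he : IsEnv lam Γ θ σ) {ν : Ordinal.{u}} {n : ℕ} {τs : Fin n → Ty.{u}}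
    {c : Fm.{u}} {ts : Fin n → Tm.{u}} (hf : IsTm lam .ind Γ (.cst ν n τs c) (.rel ν n τs))
    (hts : ∀ j, IsTm lam .ind [] (ts j) (τs j)) :
    Truth lam (.app ((Tm.cst ν n τs c).subst θ σ) n ts) ↔
      Truth lam (c.subst θ (consN n ts σ)) := by
  have h := (he.isClosed hΓ hf).isConst
  rw [Tm.subst] at h ⊢
  rw [truth_app h hts, Fm.inst_subst]

/-- Truth of a prime formula beginning with a closed constant. -/
theorem truth_app_isClosed {θ : Ty.{u} → ℕ → Tm.{u}} {σ : ℕ → Tm.{u}} {ν : Ordinal.{u}} {n : ℕ}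
    {τs : Fin n → Ty.{u}} {c : Fm.{u}} {ts : Fin n → Tm.{u}}
    (hf : IsClosed lam (.cst ν n τs c) (.rel ν n τs))
    (hts : ∀ j, IsTm lam .ind [] (ts j) (τs j)) :
    Truth lam (.app (.cst ν n τs c) n ts) ↔ Truth lam (c.subst θ (consN n ts σ)) := by
  obtain ⟨_, h, hτ, hc, hν⟩ := hf.isConst.exists_cst
  cases h
  rw [truth_app hf.isConst hts, Fm.inst_eq, hc.subst_congr]
  · intro k hk
    rw [length_ctx] at hk
    simp [consN, hk]
  · exact fun τ i h => (hf.2 τ i h).elim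

/-! ### Extensionality -/

/-- `p` and `q` are equal numerals or coextensional constants of type `τ`. -/
def Coext (lam : Ordinal.{u}) : Ty.{u} → Tm.{u} → Tm.{u} → Prop
  | .ind, p, q => p = q
  | .rel _ n τs, p, q => ∀ ts : Fin n → Tm.{u}, (∀ j, IsClosed lam (ts j) (τs j)) →
      (Truth lam (.app p n ts) ↔ Truth lam (.app q n ts))

theorem Coext.refl (τ : Ty.{u}) (p : Tm.{u}) : Coext lam τ p p := by
  cases τ with
  | ind => rfl
  | rel => exact fun _ _ => Iff.rfl

/-- The values of two environments are coextensional. -/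
structure EnvCoext (lam : Ordinal.{u}) (Γ : List Ty.{u}) (θ : Ty.{u} → ℕ → Tm.{u})
    (σ : ℕ → Tm.{u}) (θ' : Ty.{u} → ℕ → Tm.{u}) (σ' : ℕ → Tm.{u}) : Prop where
  left : IsEnv lam Γ θ σ
  right : IsEnv lam Γ θ' σ'
  free : ∀ τ i, τ.WF lam → Coext lam τ (θ τ i) (θ' τ i)
  bound : ∀ k τ, Γ[k]? = some τ → Coext lam τ (σ k) (σ' k)

theorem EnvCoext.consN {Γ : List Ty.{u}} {θ θ' : Ty.{u} → ℕ → Tm.{u}} {σ σ' : ℕ → Tm.{u}}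
    (h : EnvCoext lam Γ θ σ θ' σ') {n : ℕ} {τs : Fin n → Ty.{u}} {ts ts' : Fin n → Tm.{u}}
    (hts : ∀ j, IsClosed lam (ts j) (τs j)) (hts' : ∀ j, IsClosed lam (ts' j) (τs j))
    (hc : ∀ j, Coext lam (τs j) (ts j) (ts' j)) :
    EnvCoext lam (ctx τs ++ Γ) θ (consN n ts σ) θ' (consN n ts' σ') where
  left := h.left.consN hts
  right := h.right.consN hts'
  free := h.free
  bound k τ hk := by
    by_cases hn : k < n
    · rw [List.getElem?_append_left (by rwa [length_ctx]),
        List.getElem?_eq_getElem (by rwa [length_ctx])] at hk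
      obtain rfl := Option.some_injective _ hk
      simpa [Ramified.consN, hn, Ramified.ctx] using hc _
    · rw [List.getElem?_append_right (by rw [length_ctx]; omega), length_ctx] at hk
      simpa only [Ramified.consN, hn, dite_false] using h.bound _ _ hk

/-- Coextensional constants may be put for each other in every formula. -/
theorem EnvCoext.truth_iff {ν : Ordinal.{u}} {Γ : List Ty.{u}} {c : Fm.{u}} (hΓ : CtxWF lam Γ)
    (hc : IsFm lam .ind ν Γ c) {θ θ' : Ty.{u} → ℕ → Tm.{u}} {σ σ' : ℕ → Tm.{u}}
    (h : EnvCoext lam Γ θ σ θ' σ') :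
    Truth lam (c.subst θ σ) ↔ Truth lam (c.subst θ' σ') := by
  induction hr : rank Γ c using WellFoundedLT.induction generalizing ν Γ c θ θ' σ σ' with
  | _ r ih =>
  subst hr
  have coext : ∀ {t : Tm.{u}} {τ : Ty.{u}}, IsTm lam .ind Γ t τ →
      Ordinal.omega0 * τ.order ≤ rank Γ c → Coext lam τ (t.subst θ σ) (t.subst θ' σ') := by
    intro t τ ht hτ
    cases ht with
    | fvar hτ => exact h.free _ _ hτ
    | bvar hk => exact h.bound _ _ hk
    | num => rfl
    | cst hK hw hb hν =>
      intro ts hts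
      rw [truth_subst_app hΓ h.left (.cst hK hw hb hν) fun j => (hts j).1,
        truth_subst_app hΓ h.right (.cst hK hw hb hν) fun j => (hts j).1]
      exact ih _ ((hb.rank_lt hw.pos hν).trans_le hτ) (hΓ.append hw) hb
        (h.consN hts hts fun j => Coext.refl _ _) rfl
  cases hc with
  | bot => rfl
  | top => rfl
  | gt hK hs ht =>
    have h1 : Coext lam .ind _ _ := coext hs (by simp [Ty.order])
    have h2 : Coext lam .ind _ _ := coext ht (by simp [Ty.order])
    simp only [Coext] at h1 h2
    simp only [Fm.subst, h1, h2]
  | and ha hb =>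
    simp only [Fm.subst, truth_and]
    rw [ih _ ((le_max_left _ _).trans_lt (lt_add_one _)) hΓ ha h rfl,
      ih _ ((le_max_right _ _).trans_lt (lt_add_one _)) hΓ hb h rfl]
  | or ha hb =>
    simp only [Fm.subst, truth_or]
    rw [ih _ ((le_max_left _ _).trans_lt (lt_add_one _)) hΓ ha h rfl,
      ih _ ((le_max_right _ _).trans_lt (lt_add_one _)) hΓ hb h rfl]
  | neg ha =>
    simp only [Fm.subst, truth_neg]
    rw [ih _ (lt_add_one _) hΓ ha h rfl]
  | all hτ _ hc =>
    rw [truth_subst_all, truth_subst_all]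
    exact forall₂_congr fun t ht => ih _ (lt_add_one _) (hΓ.cons hτ) hc
      (h.consN (n := 1) (τs := fun _ => _) (fun _ => ht) (fun _ => ht)
        fun _ => Coext.refl _ _) rfl
  | ex hτ _ hc =>
    rw [truth_subst_ex, truth_subst_ex]
    exact exists_congr fun t => and_congr_right fun ht => ih _ (lt_add_one _) (hΓ.cons hτ) hc
      (h.consN (n := 1) (τs := fun _ => _) (fun _ => ht) (fun _ => ht)
        fun _ => Coext.refl _ _) rfl
  | app hμ hf hts =>
    have hw := hf.wf_rel hΓ
    have hro := hf.headOrder_eq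
    simp only [Ty.order] at hro
    have h1 := coext hf (by simp [rank, hro, Ty.order])
    have h2 := fun j => coext (hts j) (by
      simp only [rank, hro]
      exact mul_le_mul_right (hw.arg_lt j).le _)
    have h3 := fun j => h.left.isClosed hΓ (hts j)
    have h4 := fun j => h.right.isClosed hΓ (hts j)
    simp only [Fm.subst]
    rw [h1 _ h3]
    have hq := h.right.isClosed hΓ hf
    obtain ⟨b, hb, -, hbf, hba⟩ := hq.isConst.exists_cst
    rw [hb] at hq ⊢
    rw [truth_app_isClosed (θ := θ') (σ := σ') hq fun j => (h3 j).1,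
      truth_app_isClosed (θ := θ') (σ := σ') hq fun j => (h4 j).1]
    have h0 : EnvCoext lam [] θ' σ' θ' σ' :=
      ⟨⟨⟨h.right.free, fun k τ h => by simp at h⟩, h.right.noFree_free, h.right.noFree_bound⟩,
        ⟨⟨h.right.free, fun k τ h => by simp at h⟩, h.right.noFree_free, h.right.noFree_bound⟩,
        fun _ _ _ => Coext.refl _ _, fun _ _ _ => Coext.refl _ _⟩
    have h5 := h0.consN h3 h4 h2
    rw [List.append_nil] at h5
    exact ih _ (by simpa only [rank, hro] using hbf.rank_lt hw.pos hba) (CtxWF.ctx hw) hbf h5 rfl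

theorem truth_subst_coext {θ : Ty.{u} → ℕ → Tm.{u}} {σ : ℕ → Tm.{u}} {ν : Ordinal.{u}} {n : ℕ}
    {τs : Fin n → Ty.{u}} {τ τ' : Ty.{u}} {i j : ℕ} :
    Truth lam ((coext n τs (.fvar τ i) (.fvar τ' j)).subst θ σ) ↔
      Coext lam (.rel ν n τs) (θ τ i) (θ τ' j) := by
  simp only [coext, truth_subst_alls, Fm.iff, Fm.imp, Fm.subst, appVars, Tm.subst, consN_rev,
    truth_and, truth_or, truth_neg, ← imp_iff_not_or]
  exact forall₂_congr fun _ _ => iff_def.symm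

theorem truth_extensionality {θ : Ty.{u} → ℕ → Tm.{u}} {σ : ℕ → Tm.{u}} (he : IsEnv lam [] θ σ)
    {μ ν : Ordinal.{u}} {n : ℕ} {τs : Fin n → Ty.{u}} {c : Fm.{u}} {i j : ℕ}
    (hτ : (Ty.rel ν n τs).WF lam) (hc : IsFm lam .ind μ [.rel ν n τs] c)
    (h : Truth lam ((coext n τs (.fvar (.rel ν n τs) i) (.fvar (.rel ν n τs) j)).subst θ σ)) :
    Truth lam (((c.inst1 (.fvar (.rel ν n τs) i)).imp
      (c.inst1 (.fvar (.rel ν n τs) j))).subst θ σ) := by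
  rw [truth_subst_coext (ν := ν)] at h
  simp only [Fm.imp, Fm.subst, truth_or, truth_neg, ← imp_iff_not_or, Fm.inst1, Fm.subst_inst]
  have h0 : EnvCoext lam [] θ σ θ σ :=
    ⟨he, he, fun _ _ _ => Coext.refl _ _, fun _ _ _ => Coext.refl _ _⟩
  have hcl := fun i => he.isClosed CtxWF.nil (.fvar (i := i) hτ)
  exact ((h0.consN (n := 1) (τs := fun _ => .rel ν n τs) (fun _ => hcl i) (fun _ => hcl j)
    fun _ => h).truth_iff (CtxWF.nil.cons hτ) hc).1

/-! ### Comprehension -/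

/-- A formula of order `ν` without free variables is equivalent to one that avoids the order `ν`, if
all its indices have types of lower orders. -/
theorem IsFm.exists_avoids {ν : Ordinal.{u}} (h0 : 0 < ν) : ∀ {Γ : List Ty.{u}} {c : Fm.{u}},
    IsFm lam .ind ν Γ c → CtxWF lam Γ → (∀ τ ∈ Γ, τ.order < ν) → (∀ τ i, ¬ c.Occurs τ i) →
    ∃ c', IsFm lam .ind ν Γ c' ∧ c'.Avoids ν Γ ∧ (∀ τ i, ¬ c'.Occurs τ i) ∧
      ∀ θ σ, IsEnv lam Γ θ σ → (Truth lam (c'.subst θ σ) ↔ Truth lam (c.subst θ σ))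
  | _, _, .bot hK, _, _, _ => ⟨_, .bot hK, trivial, fun _ _ h => h, fun _ _ _ => Iff.rfl⟩
  | _, _, .top hK, _, _, _ => ⟨_, .top hK, trivial, fun _ _ h => h, fun _ _ _ => Iff.rfl⟩
  | _, _, .gt hK hs ht, hΓ, _, ho =>
    ⟨_, .gt hK hs ht, ⟨hs.avoids hΓ h0, ht.avoids hΓ h0⟩, ho, fun _ _ _ => Iff.rfl⟩
  | Γ, _, .app (μ := μ) (f := f) (n := n) (ts := ts) hμ hf hts, hΓ, hν, ho => by
    have hw := hf.wf_rel hΓ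
    rcases hμ.lt_or_eq with hlt | rfl
    · exact ⟨_, .app hμ hf hts, ⟨hf.avoids hΓ hlt, fun j =>
        (hts j).avoids hΓ ((hw.arg_lt j).trans hlt)⟩, ho, fun _ _ _ => Iff.rfl⟩
    · cases hf with
      | fvar => exact absurd (Or.inl ⟨rfl, rfl⟩) (ho _ _)
      | bvar h => exact absurd (hν _ (List.mem_of_getElem? h)) (lt_irrefl _)
      | cst hK hτ hb hbν =>
        have h1 := hb.inst hΓ hτ.arg hts
        refine ⟨_, h1.1, h1.2 _ le_rfl hbν, fun τ i h => ?_, fun θ σ he => ?_⟩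
        · rcases Fm.occurs_subst _ h with ⟨τ', i', h1, h2⟩ | ⟨k, hk⟩
          · obtain ⟨rfl, rfl⟩ := h2
            exact ho _ _ (.inl h1)
          · by_cases hkn : k < n
            · simp only [hkn, dite_true] at hk
              exact ho _ _ (.inr ⟨_, hk⟩)
            · simp [hkn, Tm.Occurs] at hk
        · rw [Fm.subst_inst]
          exact (truth_subst_app hΓ he (.cst hK hτ hb hbν)
            fun j => (he.isClosed hΓ (hts j)).1).symm
  | _, _, .and ha hb, hΓ, hν, ho => by
    obtain ⟨a', h1, h2, h3, h4⟩ := ha.exists_avoids h0 hΓ hν fun τ i h => ho τ i (.inl h)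
    obtain ⟨b', k1, k2, k3, k4⟩ := hb.exists_avoids h0 hΓ hν fun τ i h => ho τ i (.inr h)
    refine ⟨_, .and h1 k1, ⟨h2, k2⟩, fun τ i h => h.elim (h3 τ i) (k3 τ i), fun θ σ he => ?_⟩
    simp only [Fm.subst, truth_and, h4 θ σ he, k4 θ σ he]
  | _, _, .or ha hb, hΓ, hν, ho => by
    obtain ⟨a', h1, h2, h3, h4⟩ := ha.exists_avoids h0 hΓ hν fun τ i h => ho τ i (.inl h)
    obtain ⟨b', k1, k2, k3, k4⟩ := hb.exists_avoids h0 hΓ hν fun τ i h => ho τ i (.inr h)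
    refine ⟨_, .or h1 k1, ⟨h2, k2⟩, fun τ i h => h.elim (h3 τ i) (k3 τ i), fun θ σ he => ?_⟩
    simp only [Fm.subst, truth_or, h4 θ σ he, k4 θ σ he]
  | _, _, .neg ha, hΓ, hν, ho => by
    obtain ⟨a', h1, h2, h3, h4⟩ := ha.exists_avoids h0 hΓ hν ho
    refine ⟨_, .neg h1, h2, h3, fun θ σ he => ?_⟩
    simp only [Fm.subst, truth_neg, h4 θ σ he]
  | _, _, .all hτ hlt hc, hΓ, hν, ho => by
    obtain ⟨c', h1, h2, h3, h4⟩ := hc.exists_avoids h0 (hΓ.cons hτ)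
      (fun σ hσ => (List.mem_cons.1 hσ).elim (fun h => h ▸ hlt) (hν σ)) ho
    refine ⟨_, .all hτ hlt h1, ⟨hlt.ne, h2⟩, h3, fun θ σ he => ?_⟩
    rw [truth_subst_all, truth_subst_all]
    exact forall₂_congr fun t ht => h4 _ _ (he.cons ht)
  | _, _, .ex hτ hlt hc, hΓ, hν, ho => by
    obtain ⟨c', h1, h2, h3, h4⟩ := hc.exists_avoids h0 (hΓ.cons hτ)
      (fun σ hσ => (List.mem_cons.1 hσ).elim (fun h => h ▸ hlt) (hν σ)) ho
    refine ⟨_, .ex hτ hlt h1, ⟨hlt.ne, h2⟩, h3, fun θ σ he => ?_⟩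
    rw [truth_subst_ex, truth_subst_ex]
    exact exists_congr fun t => and_congr_right fun ht => h4 _ _ (he.cons ht)

theorem truth_comprehension {θ : Ty.{u} → ℕ → Tm.{u}} {σ : ℕ → Tm.{u}} (he : IsEnv lam [] θ σ)
    {ν : Ordinal.{u}} {n : ℕ} {τs : Fin n → Ty.{u}} {c : Fm.{u}}
    (hτ : (Ty.rel ν n τs).WF lam) (hc : IsFm lam .ind ν (ctx τs) c) :
    Truth lam ((comprehension ν n τs c).subst θ σ) := by
  have hΓ := CtxWF.ctx hτ
  have hs : IsSubst lam (ctx τs) (ctx τs) (upFree n θ) (upBound n σ) := by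
    simpa only [List.append_nil] using he.toIsSubst.up_ctx τs
  have ho : ∀ τ i, ¬ (c.subst (upFree n θ) (upBound n σ)).Occurs τ i := by
    intro τ i h
    rcases c.occurs_subst h with ⟨_, _, _, h⟩ | h
    · exact he.noFree_free _ _ _ _ ((Tm.occurs_rename _ _ _ _).1 h)
    · obtain ⟨k, hk⟩ := occurs_upBound h
      exact he.noFree_bound _ _ _ hk
  obtain ⟨c', h1, h2, h3, h4⟩ := (hc.subst hΓ hΓ hs).exists_avoids hτ.pos hΓ
    (fun τ h => by obtain ⟨j, rfl⟩ := mem_ctx.1 h; exact hτ.arg_lt j) ho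
  have hcl : IsClosed lam (.cst ν n τs c') (.rel ν n τs) :=
    ⟨.cst rfl hτ (by simpa using h1) (by simpa using h2), h3⟩
  rw [comprehension, truth_subst_ex]
  refine ⟨_, hcl, ?_⟩
  rw [truth_subst_alls]
  intro ts hts
  have he' := he.consN hts
  rw [List.append_nil] at he'
  have hn : consN n ts (consN 1 (fun _ => .cst ν n τs c') σ) n = .cst ν n τs c' := by
    simp [consN]
  simp only [Fm.iff, Fm.imp, Fm.subst, appVars, Tm.subst, consN_rev, hn, truth_and, truth_or,
    truth_neg, ← imp_iff_not_or]
  have e1 : c.subst θ (consN n ts (consN 1 (fun _ => .cst ν n τs c') σ)) =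
      c.subst θ (consN n ts σ) := by
    refine hc.subst_congr (fun k hk => ?_) fun _ _ _ => rfl
    rw [length_ctx] at hk
    simp [consN, hk]
  have e2 : (c.subst (upFree n θ) (upBound n σ)).subst θ (consN n ts σ) =
      c.subst θ (consN n ts σ) := by
    rw [← Fm.inst_subst c n ts θ σ, Fm.inst_eq]
    refine (hc.subst hΓ hΓ hs).subst_congr (fun k hk => ?_) fun τ i h => (ho τ i h).elim
    rw [length_ctx] at hk
    simp [consN, hk]
  rw [← iff_def, truth_app_isClosed (θ := θ) (σ := σ) hcl fun j => (hts j).1, h4 _ _ he', e1, e2]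

/-! ### Infinity -/

theorem isClosed_ind {t : Tm.{u}} : IsClosed lam t .ind ↔ ∃ k, t = .num k := by
  refine ⟨fun h => h.isConst.exists_num, ?_⟩
  rintro ⟨k, rfl⟩
  exact ⟨.num rfl, fun _ _ h => h⟩

theorem truth_infinity {θ : Ty.{u} → ℕ → Tm.{u}} {σ : ℕ → Tm.{u}} (h : 1 < lam) :
    Truth lam (infinity.subst θ σ) := by
  have hτ : (Ty.rel 1 2 fun _ => .ind).WF lam := by
    simp only [Ty.WF]
    exact ⟨h, two_pos, fun _ => ⟨zero_lt_one.trans h, zero_lt_one⟩⟩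
  have hcl : IsClosed lam (.cst 1 2 (fun _ => .ind) (.gt (.bvar 0) (.bvar 1)))
      (.rel 1 2 fun _ => .ind) := by
    have h1 : IsFm lam .ind 1 (ctx (fun _ : Fin 2 => Ty.ind.{u}) ++ [])
        (.gt (.bvar 0) (.bvar 1)) := .gt rfl (.bvar rfl) (.bvar rfl)
    have h2 : ∀ k, (Tm.bvar k).Avoids 1 (ctx (fun _ : Fin 2 => Ty.ind.{u}) ++ []) := by
      intro k τ hk
      rw [List.append_nil] at hk
      obtain ⟨_, rfl⟩ := mem_ctx.1 (List.mem_of_getElem? hk)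
      exact zero_ne_one
    exact ⟨.cst rfl hτ h1 ⟨h2 0, h2 1⟩, fun _ _ h => h.elim id id⟩
  have key : ∀ a b : ℕ, Truth lam (app2 (.cst 1 2 (fun _ => .ind) (.gt (.bvar 0) (.bvar 1)))
      (.num a) (.num b)) ↔ b > a := by
    intro a b
    rw [app2, truth_app hcl.isConst, Fm.inst_eq, ← truth_gt (lam := lam)]
    · rfl
    · intro j
      refine Fin.cases ?_ (fun j => ?_) j
      · exact .num rfl
      · exact Fin.cases (.num rfl) (fun j => j.elim0) j
  have happ : ∀ (θ : Ty.{u} → ℕ → Tm.{u}) (σ : ℕ → Tm.{u}) (f s t : Tm.{u}),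
      (app2 f s t).subst θ σ = app2 (f.subst θ σ) (s.subst θ σ) (t.subst θ σ) := by
    intro θ σ f s t
    simp only [app2, Fm.subst]
    congr 1
    funext j
    refine Fin.cases rfl (fun j => ?_) j
    exact Fin.cases rfl (fun j => j.elim0) j
  rw [infinity, truth_subst_ex]
  refine ⟨_, hcl, ?_⟩
  rw [Fm.subst, truth_and, Fm.subst, truth_and]
  refine ⟨⟨?_, ?_⟩, ?_⟩
  · rw [truth_subst_all]
    intro t ht
    obtain ⟨a, rfl⟩ := isClosed_ind.1 ht
    rw [Fm.subst, truth_neg, happ]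
    exact fun h => lt_irrefl _ ((key a a).1 h)
  · rw [truth_subst_all]
    intro t ht
    obtain ⟨a, rfl⟩ := isClosed_ind.1 ht
    rw [truth_subst_ex]
    refine ⟨.num (a + 1), isClosed_ind.2 ⟨_, rfl⟩, ?_⟩
    rw [happ]
    exact (key a (a + 1)).2 (Nat.lt_succ_self a)
  · rw [truth_subst_all]
    intro t ht
    obtain ⟨a, rfl⟩ := isClosed_ind.1 ht
    rw [truth_subst_all]
    intro t ht
    obtain ⟨b, rfl⟩ := isClosed_ind.1 ht
    rw [truth_subst_all]
    intro t ht
    obtain ⟨c, rfl⟩ := isClosed_ind.1 ht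
    simp only [Fm.imp, Fm.subst, happ, truth_or, truth_neg, truth_and, ← imp_iff_not_or]
    rintro ⟨h1, h2⟩
    exact (key a c).2 (((key a b).1 h1).trans ((key b c).1 h2))

/-! ### Sound pairs -/

@[simp] theorem isFormula_and {a b : Fm.{u}} :
    IsFormula lam .ind (.and a b) ↔ IsFormula lam .ind a ∧ IsFormula lam .ind b := by
  constructor
  · rintro ⟨ν, h0, h1, h⟩
    cases h with
    | and ha hb => exact ⟨⟨ν, h0, h1, ha⟩, ⟨ν, h0, h1, hb⟩⟩
  · rintro ⟨⟨ν, h0, h1, ha⟩, ⟨μ, h2, h3, hb⟩⟩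
    exact ⟨max ν μ, lt_max_of_lt_left h0, max_lt h1 h3,
      .and (ha.mono (le_max_left _ _)) (hb.mono (le_max_right _ _))⟩

@[simp] theorem isFormula_or {a b : Fm.{u}} :
    IsFormula lam .ind (.or a b) ↔ IsFormula lam .ind a ∧ IsFormula lam .ind b := by
  constructor
  · rintro ⟨ν, h0, h1, h⟩
    cases h with
    | or ha hb => exact ⟨⟨ν, h0, h1, ha⟩, ⟨ν, h0, h1, hb⟩⟩
  · rintro ⟨⟨ν, h0, h1, ha⟩, ⟨μ, h2, h3, hb⟩⟩
    exact ⟨max ν μ, lt_max_of_lt_left h0, max_lt h1 h3,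
      .or (ha.mono (le_max_left _ _)) (hb.mono (le_max_right _ _))⟩

@[simp] theorem isFormula_neg {a : Fm.{u}} :
    IsFormula lam .ind (.neg a) ↔ IsFormula lam .ind a := by
  constructor
  · rintro ⟨ν, h0, h1, h⟩
    cases h with
    | neg ha => exact ⟨ν, h0, h1, ha⟩
  · rintro ⟨ν, h0, h1, ha⟩
    exact ⟨ν, h0, h1, .neg ha⟩

theorem isFormula_all {τ : Ty.{u}} {c : Fm.{u}} (h : IsFormula lam .ind (.all τ c)) :
    τ.WF lam ∧ IsFormulaIn lam .ind [τ] c := by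
  obtain ⟨ν, h0, h1, h⟩ := h
  cases h with
  | all hτ _ hc => exact ⟨hτ, ν, h0, h1, hc⟩

theorem isFormula_ex {τ : Ty.{u}} {c : Fm.{u}} (h : IsFormula lam .ind (.ex τ c)) :
    τ.WF lam ∧ IsFormulaIn lam .ind [τ] c := by
  obtain ⟨ν, h0, h1, h⟩ := h
  cases h with
  | ex hτ _ hc => exact ⟨hτ, ν, h0, h1, hc⟩

theorem IsFormulaIn.inst1 {τ : Ty.{u}} {c : Fm.{u}} {t : Tm.{u}} (hτ : τ.WF lam)
    (h : IsFormulaIn lam .ind [τ] c) (ht : IsTm lam .ind [] t τ) :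
    IsFormula lam .ind (c.inst1 t) := by
  obtain ⟨ν, h0, h1, h⟩ := h
  exact ⟨ν, h0, h1, (h.inst (n := 1) (τs := fun _ => τ) CtxWF.nil (fun _ => hτ) fun _ => ht).1⟩

/-- `a` is omitted or an inductive formula. -/
def WFOpt (lam : Ordinal.{u}) (a : Option Fm.{u}) : Prop := ∀ c ∈ a, IsFormula lam .ind c

@[simp] theorem wfOpt_none : WFOpt lam none := fun _ h => by cases h

@[simp] theorem wfOpt_some {c : Fm.{u}} : WFOpt lam (some c) ↔ IsFormula lam .ind c := by
  simp [WFOpt]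

@[simp] theorem isFormula_andL {a : Option Fm.{u}} {c : Fm.{u}} :
    IsFormula lam .ind (andL a c) ↔ WFOpt lam a ∧ IsFormula lam .ind c := by
  cases a <;> simp [andL]

@[simp] theorem isFormula_andR {a : Option Fm.{u}} {c : Fm.{u}} :
    IsFormula lam .ind (andR c a) ↔ IsFormula lam .ind c ∧ WFOpt lam a := by
  cases a <;> simp [andR]

@[simp] theorem isFormula_orL {a : Option Fm.{u}} {c : Fm.{u}} :
    IsFormula lam .ind (orL a c) ↔ WFOpt lam a ∧ IsFormula lam .ind c := by
  cases a <;> simp [orL]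

@[simp] theorem isFormula_orR {a : Option Fm.{u}} {c : Fm.{u}} :
    IsFormula lam .ind (orR c a) ↔ IsFormula lam .ind c ∧ WFOpt lam a := by
  cases a <;> simp [orR]

/-- Truth of a formula under a substitution for its free variables. -/
def TrueAt (lam : Ordinal.{u}) (θ : Ty.{u} → ℕ → Tm.{u}) (c : Fm.{u}) : Prop :=
  Truth lam (c.subst θ Tm.bvar)

/-- Truth of a left side; an omitted one is true. -/
def HypAt (lam : Ordinal.{u}) (θ : Ty.{u} → ℕ → Tm.{u}) (a : Option Fm.{u}) : Prop :=
  ∀ c ∈ a, TrueAt lam θ c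

/-- Truth of a right side; an omitted one is false. -/
def ConAt (lam : Ordinal.{u}) (θ : Ty.{u} → ℕ → Tm.{u}) (a : Option Fm.{u}) : Prop :=
  ∃ c ∈ a, TrueAt lam θ c

section

variable {θ : Ty.{u} → ℕ → Tm.{u}} {a : Option Fm.{u}} {c d : Fm.{u}}

@[simp] theorem trueAt_and : TrueAt lam θ (.and c d) ↔ TrueAt lam θ c ∧ TrueAt lam θ d := truth_and

@[simp] theorem trueAt_or : TrueAt lam θ (.or c d) ↔ TrueAt lam θ c ∨ TrueAt lam θ d := truth_or

@[simp] theorem trueAt_neg : TrueAt lam θ (.neg c) ↔ ¬ TrueAt lam θ c := truth_neg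

@[simp] theorem hypAt_none : HypAt lam θ none ↔ True := by simp [HypAt]

@[simp] theorem hypAt_some : HypAt lam θ (some c) ↔ TrueAt lam θ c := by simp [HypAt]

@[simp] theorem conAt_none : ConAt lam θ none ↔ False := by simp [ConAt]

@[simp] theorem conAt_some : ConAt lam θ (some c) ↔ TrueAt lam θ c := by simp [ConAt]

@[simp] theorem trueAt_andL : TrueAt lam θ (andL a c) ↔ HypAt lam θ a ∧ TrueAt lam θ c := by
  cases a <;> simp [andL]

@[simp] theorem trueAt_andR : TrueAt lam θ (andR c a) ↔ TrueAt lam θ c ∧ HypAt lam θ a := by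
  cases a <;> simp [andR]

@[simp] theorem trueAt_orL : TrueAt lam θ (orL a c) ↔ ConAt lam θ a ∨ TrueAt lam θ c := by
  cases a <;> simp [orL]

@[simp] theorem trueAt_orR : TrueAt lam θ (orR c a) ↔ TrueAt lam θ c ∨ ConAt lam θ a := by
  cases a <;> simp [orR]

theorem trueAt_all {τ : Ty.{u}} : TrueAt lam θ (.all τ c) ↔
    ∀ t, IsClosed lam t τ → Truth lam (c.subst θ (consN 1 (fun _ => t) Tm.bvar)) :=
  truth_subst_all

theorem trueAt_ex {τ : Ty.{u}} : TrueAt lam θ (.ex τ c) ↔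
    ∃ t, IsClosed lam t τ ∧ Truth lam (c.subst θ (consN 1 (fun _ => t) Tm.bvar)) :=
  truth_subst_ex

theorem trueAt_inst1 {t : Tm.{u}} : TrueAt lam θ (c.inst1 t) ↔
    Truth lam (c.subst θ (consN 1 (fun _ => t.subst θ Tm.bvar) Tm.bvar)) := by
  rw [TrueAt, Fm.inst1, Fm.subst_inst]

end

open Classical in
/-- The substitution `θ`, changed to `t` at `(τ)ᵢ`. -/
noncomputable def update (θ : Ty.{u} → ℕ → Tm.{u}) (τ : Ty.{u}) (i : ℕ) (t : Tm.{u}) :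
    Ty.{u} → ℕ → Tm.{u} := fun σ j => if σ = τ ∧ j = i then t else θ σ j

theorem update_self (θ : Ty.{u} → ℕ → Tm.{u}) (τ : Ty.{u}) (i : ℕ) (t : Tm.{u}) :
    update θ τ i t τ i = t := by simp [update]

theorem IsEnv.update {θ : Ty.{u} → ℕ → Tm.{u}} {σ : ℕ → Tm.{u}} (h : IsEnv lam [] θ σ)
    {τ : Ty.{u}} (i : ℕ) {t : Tm.{u}} (ht : IsClosed lam t τ) :
    IsEnv lam [] (update θ τ i t) σ where
  free τ' j hτ' := by
    unfold Ramified.update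
    split_ifs with he
    · exact he.1 ▸ ht.1
    · exact h.free τ' j hτ'
  bound := h.bound
  noFree_free τ' j := by
    unfold Ramified.update
    split_ifs with he
    · exact ht.2
    · exact h.noFree_free τ' j
  noFree_bound := h.noFree_bound

theorem subst_update {ν : Ordinal.{u}} {K : Calc} {Γ : List Ty.{u}} {c : Fm.{u}}
    (hc : IsFm lam K ν Γ c) {τ : Ty.{u}} {i : ℕ} (hi : ¬ c.Occurs τ i) (t : Tm.{u})
    (θ : Ty.{u} → ℕ → Tm.{u}) (σ : ℕ → Tm.{u}) : c.subst (update θ τ i t) σ = c.subst θ σ := by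
  refine hc.subst_congr (fun _ _ => rfl) fun τ' j h => ?_
  have : ¬ (τ' = τ ∧ j = i) := by
    rintro ⟨rfl, rfl⟩
    exact hi h
  simp [update, this]

theorem hypAt_update {a : Option Fm.{u}} (ha : WFOpt lam a) {τ : Ty.{u}} {i : ℕ}
    (hi : Fresh τ i a) (t : Tm.{u}) (θ : Ty.{u} → ℕ → Tm.{u}) :
    HypAt lam (update θ τ i t) a ↔ HypAt lam θ a := by
  refine forall₂_congr fun c hc => ?_
  obtain ⟨ν, _, _, h⟩ := ha c hc
  rw [TrueAt, TrueAt, subst_update h (hi c hc)]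

theorem conAt_update {a : Option Fm.{u}} (ha : WFOpt lam a) {τ : Ty.{u}} {i : ℕ}
    (hi : Fresh τ i a) (t : Tm.{u}) (θ : Ty.{u} → ℕ → Tm.{u}) :
    ConAt lam (update θ τ i t) a ↔ ConAt lam θ a := by
  refine exists_congr fun c => and_congr_right fun hc => ?_
  obtain ⟨ν, _, _, h⟩ := ha c hc
  rw [TrueAt, TrueAt, subst_update h (hi c hc)]

theorem trueAt_inst1_update {τ : Ty.{u}} {c : Fm.{u}} (h : IsFormulaIn lam .ind [τ] c) {i : ℕ}
    (hi : ¬ c.Occurs τ i) (t : Tm.{u}) (θ : Ty.{u} → ℕ → Tm.{u}) :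
    TrueAt lam (update θ τ i t) (c.inst1 (.fvar τ i)) ↔
      Truth lam (c.subst θ (consN 1 (fun _ => t) Tm.bvar)) := by
  obtain ⟨ν, _, _, h⟩ := h
  rw [trueAt_inst1, Tm.subst, update_self, subst_update h hi]

/-- Both sides are formulas, and the right side is true whenever the left side is, for all closed
constants substituted for the free variables. -/
structure Sound (lam : Ordinal.{u}) (a b : Option Fm.{u}) : Prop where
  left : WFOpt lam a
  right : WFOpt lam b
  valid : ∀ θ, IsEnv lam [] θ Tm.bvar → HypAt lam θ a → ConAt lam θ b

namespace Sound

variable {a b : Option Fm.{u}} {c d : Fm.{u}} {τ : Ty.{u}} {i : ℕ}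

theorem not_none_none : ¬ Sound lam none none := fun h => by
  obtain ⟨θ, hθ⟩ := exists_isEnv lam
  simpa using h.valid θ hθ

theorem refl (hc : IsFormula lam .ind c) : Sound lam (some c) (some c) :=
  ⟨wfOpt_some.2 hc, wfOpt_some.2 hc, fun _ _ => by simp⟩

theorem cut (h₁ : Sound lam a (some c)) (h₂ : Sound lam (some c) b) : Sound lam a b :=
  ⟨h₁.left, h₂.right, fun θ hθ h =>
    h₂.valid θ hθ (hypAt_some.2 (conAt_some.1 (h₁.valid θ hθ h)))⟩

theorem comp {ν : Ordinal.{u}} {n : ℕ} {τs : Fin n → Ty.{u}} (hc : IsFm lam .ind ν (ctx τs) c)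
    (h : IsFormula lam .ind (comprehension ν n τs c)) :
    Sound lam none (some (comprehension ν n τs c)) :=
  ⟨wfOpt_none, wfOpt_some.2 h, fun _ hθ _ =>
    conAt_some.2 (truth_comprehension hθ (isFormula_ex h).1 hc)⟩

theorem ext {ν : Ordinal.{u}} {n : ℕ} {τs : Fin n → Ty.{u}} {j : ℕ}
    (hτ : (Ty.rel ν n τs).WF lam) (hc : IsFormulaIn lam .ind [.rel ν n τs] c) :
    Sound lam (some (coext n τs (.fvar (.rel ν n τs) i) (.fvar (.rel ν n τs) j)))
      (some ((c.inst1 (.fvar (.rel ν n τs) i)).imp (c.inst1 (.fvar (.rel ν n τs) j)))) := by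
  refine ⟨wfOpt_some.2 ⟨ν, hτ.pos, hτ.lt, ?_⟩, wfOpt_some.2 ?_, fun θ hθ h => ?_⟩
  · have h1 : ∀ k, IsFm lam .ind ν (ctx τs ++ []) (appVars (.fvar (.rel ν n τs) k) n) := by
      refine fun k => .app le_rfl (.fvar hτ) fun j => .bvar ?_
      rw [List.append_nil, List.getElem?_eq_getElem (by rw [length_ctx]; exact Fin.is_lt _)]
      simp only [ctx, List.getElem_ofFn, Fin.eta, Fin.rev_rev]
    exact .alls hτ.arg hτ.arg_lt
      (.and (.or (.neg (h1 i)) (h1 j)) (.or (.neg (h1 j)) (h1 i)))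
  · simp only [Fm.imp, isFormula_or, isFormula_neg]
    exact ⟨hc.inst1 hτ (.fvar hτ), hc.inst1 hτ (.fvar hτ)⟩
  · obtain ⟨μ, _, _, hc⟩ := hc
    exact conAt_some.2 (truth_extensionality hθ hτ hc (hypAt_some.1 h))

theorem inf (h : IsFormula.{u} lam .ind infinity) : Sound lam none (some infinity) :=
  ⟨wfOpt_none, wfOpt_some.2 h, fun _ _ _ => conAt_some.2 (truth_infinity (isFormula_ex h).1.lt)⟩

theorem weak_left (hc : IsFormula lam .ind c) (h : Sound lam a b) : Sound lam (some (andL a c)) b :=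
  ⟨by simp [h.left, hc], h.right, fun θ hθ ha => h.valid θ hθ (by simp at ha; exact ha.1)⟩

theorem weak_left' (hc : IsFormula lam .ind c) (h : Sound lam a b) :
    Sound lam (some (andR c a)) b :=
  ⟨by simp [h.left, hc], h.right, fun θ hθ ha => h.valid θ hθ (by simp at ha; exact ha.2)⟩

theorem weak_right (hc : IsFormula lam .ind c) (h : Sound lam a b) :
    Sound lam a (some (orL b c)) :=
  ⟨h.left, by simp [h.right, hc], fun θ hθ ha => by simp [h.valid θ hθ ha]⟩

theorem weak_right' (hc : IsFormula lam .ind c) (h : Sound lam a b) :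
    Sound lam a (some (orR c b)) :=
  ⟨h.left, by simp [h.right, hc], fun θ hθ ha => by simp [h.valid θ hθ ha]⟩

theorem and_right {b : Option Fm.{u}} (h₁ : Sound lam a (some (orR c b)))
    (h₂ : Sound lam a (some (orR d b))) : Sound lam a (some (orR (.and c d) b)) := by
  have k₁ := h₁.right
  have k₂ := h₂.right
  simp only [wfOpt_some, isFormula_orR] at k₁ k₂
  refine ⟨h₁.left, by simp [k₁, k₂], fun θ hθ ha => ?_⟩
  have l₁ := h₁.valid θ hθ ha
  have l₂ := h₂.valid θ hθ ha
  simp only [conAt_some, trueAt_orR, trueAt_and] at *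
  tauto

theorem or_left {a : Option Fm.{u}} (h₁ : Sound lam (some (andR c a)) b)
    (h₂ : Sound lam (some (andR d a)) b) : Sound lam (some (andR (.or c d) a)) b := by
  have k₁ := h₁.left
  have k₂ := h₂.left
  simp only [wfOpt_some, isFormula_andR] at k₁ k₂
  refine ⟨by simp [k₁, k₂], h₁.right, fun θ hθ ha => ?_⟩
  have l₁ := h₁.valid θ hθ
  have l₂ := h₂.valid θ hθ
  simp only [hypAt_some, trueAt_andR, trueAt_or] at *
  tauto

theorem neg_right (h : Sound lam (some (andL a c)) b) : Sound lam a (some (orL b (.neg c))) := by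
  have k := h.left
  simp only [wfOpt_some, isFormula_andL] at k
  refine ⟨k.1, by simp [k.2, h.right], fun θ hθ ha => ?_⟩
  have l := h.valid θ hθ
  simp only [hypAt_some, conAt_some, trueAt_andL, trueAt_orL, trueAt_neg] at *
  tauto

theorem neg_left (h : Sound lam a (some (orL b c))) : Sound lam (some (andL a (.neg c))) b := by
  have k := h.right
  simp only [wfOpt_some, isFormula_orL] at k
  refine ⟨by simp [k.2, h.left], k.1, fun θ hθ ha => ?_⟩
  have l := h.valid θ hθ
  simp only [hypAt_some, conAt_some, trueAt_andL, trueAt_orL, trueAt_neg] at *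
  tauto

theorem all_spec (h : Sound lam a (some (.all τ c))) :
    Sound lam a (some (c.inst1 (.fvar τ i))) := by
  obtain ⟨hτ, hc⟩ := isFormula_all (wfOpt_some.1 h.right)
  refine ⟨h.left, wfOpt_some.2 (hc.inst1 hτ (.fvar hτ)), fun θ hθ ha => ?_⟩
  have h1 := h.valid θ hθ ha
  rw [conAt_some, trueAt_all] at h1
  rw [conAt_some, trueAt_inst1]
  exact h1 _ (hθ.isClosed CtxWF.nil (.fvar hτ))

theorem ex_spec (h : Sound lam (some (.ex τ c)) b) : Sound lam (some (c.inst1 (.fvar τ i))) b := by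
  obtain ⟨hτ, hc⟩ := isFormula_ex (wfOpt_some.1 h.left)
  refine ⟨wfOpt_some.2 (hc.inst1 hτ (.fvar hτ)), h.right, fun θ hθ ha => h.valid θ hθ ?_⟩
  rw [hypAt_some, trueAt_inst1] at ha
  rw [hypAt_some, trueAt_ex]
  exact ⟨_, hθ.isClosed CtxWF.nil (.fvar hτ), ha⟩

theorem all_right (hc : IsFormula lam .ind (.all τ c)) (ha : Fresh τ i a) (hb : Fresh τ i b)
    (hi : ¬ c.Occurs τ i) (h : Sound lam a (some (orL b (c.inst1 (.fvar τ i))))) :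
    Sound lam a (some (orL b (.all τ c))) := by
  have k := h.right
  simp only [wfOpt_some, isFormula_orL] at k
  refine ⟨h.left, by simp [k.1, hc], fun θ hθ hta => ?_⟩
  rw [conAt_some, trueAt_orL, trueAt_all, or_iff_not_imp_left]
  intro hnb t ht
  have h1 := h.valid _ (hθ.update i ht) ((hypAt_update h.left ha t θ).2 hta)
  rw [conAt_some, trueAt_orL, conAt_update k.1 hb, trueAt_inst1_update (isFormula_all hc).2 hi] at h1
  exact h1.resolve_left hnb

theorem ex_left (hc : IsFormula lam .ind (.ex τ c)) (ha : Fresh τ i a) (hb : Fresh τ i b)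
    (hi : ¬ c.Occurs τ i) (h : Sound lam (some (andL a (c.inst1 (.fvar τ i)))) b) :
    Sound lam (some (andL a (.ex τ c))) b := by
  have k := h.left
  simp only [wfOpt_some, isFormula_andL] at k
  refine ⟨by simp [k.1, hc], h.right, fun θ hθ hta => ?_⟩
  rw [hypAt_some, trueAt_andL, trueAt_ex] at hta
  obtain ⟨hta, t, ht, htc⟩ := hta
  have h1 := h.valid _ (hθ.update i ht)
  rw [hypAt_some, trueAt_andL, conAt_update h.right hb, hypAt_update k.1 ha,
    trueAt_inst1_update (isFormula_ex hc).2 hi] at h1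
  exact h1 ⟨hta, htc⟩

theorem all_left {t : Tm.{u}} (hc : IsFormula lam .ind (.all τ c)) (ht : IsTm lam .ind [] t τ)
    (h : Sound lam (some (andL a (c.inst1 t))) b) : Sound lam (some (andL a (.all τ c))) b := by
  have k := h.left
  simp only [wfOpt_some, isFormula_andL] at k
  refine ⟨by simp [k.1, hc], h.right, fun θ hθ hta => h.valid θ hθ ?_⟩
  rw [hypAt_some, trueAt_andL, trueAt_all] at hta
  rw [hypAt_some, trueAt_andL, trueAt_inst1]
  exact ⟨hta.1, hta.2 _ (hθ.isClosed CtxWF.nil ht)⟩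

theorem ex_right {t : Tm.{u}} (hc : IsFormula lam .ind (.ex τ c)) (ht : IsTm lam .ind [] t τ)
    (h : Sound lam a (some (orL b (c.inst1 t)))) : Sound lam a (some (orL b (.ex τ c))) := by
  have k := h.right
  simp only [wfOpt_some, isFormula_orL] at k
  refine ⟨h.left, by simp [k.1, hc], fun θ hθ hta => ?_⟩
  have h1 := h.valid θ hθ hta
  rw [conAt_some, trueAt_orL, trueAt_inst1] at h1
  rw [conAt_some, trueAt_orL, trueAt_ex]
  exact h1.imp_right fun h => ⟨_, hθ.isClosed CtxWF.nil ht, h⟩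

end Sound

theorem fresh_none {τ : Ty.{u}} {i : ℕ} : Fresh τ i none := fun _ h => by cases h

theorem fresh_some {τ : Ty.{u}} {i : ℕ} {c : Fm.{u}} (h : ¬ c.Occurs τ i) : Fresh τ i (some c) :=
  fun d hd => by
    cases hd
    exact h

/-! ### Soundness of the inductive calculus -/

theorem AndStep.isFormula {a b : Fm.{u}} (h : AndStep a b) :
    IsFormula lam .ind a ↔ IsFormula lam .ind b := by
  induction h with
  | assoc₁ | assoc₂ => simp [and_assoc]
  | comm => simp [and_comm]
  | contr => simp
  | left _ _ ih => simp [ih]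
  | right _ _ ih => simp [ih]

theorem AndStep.trueAt {a b : Fm.{u}} (h : AndStep a b) (θ : Ty.{u} → ℕ → Tm.{u}) :
    TrueAt lam θ a ↔ TrueAt lam θ b := by
  induction h with
  | assoc₁ | assoc₂ => simp [and_assoc]
  | comm => simp [and_comm]
  | contr => simp
  | left _ _ ih => simp [ih]
  | right _ _ ih => simp [ih]

theorem OrStep.isFormula {a b : Fm.{u}} (h : OrStep a b) :
    IsFormula lam .ind a ↔ IsFormula lam .ind b := by
  induction h with
  | assoc₁ | assoc₂ => simp [and_assoc]
  | comm => simp [and_comm]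
  | contr => simp
  | left _ _ ih => simp [ih]
  | right _ _ ih => simp [ih]

theorem OrStep.trueAt {a b : Fm.{u}} (h : OrStep a b) (θ : Ty.{u} → ℕ → Tm.{u}) :
    TrueAt lam θ a ↔ TrueAt lam θ b := by
  induction h with
  | assoc₁ | assoc₂ => simp [or_assoc]
  | comm => simp [or_comm]
  | contr => simp
  | left _ _ ih => simp [ih]
  | right _ _ ih => simp [ih]

theorem truth_subst_eliminate {t : Tm.{u}} {μ : Ordinal.{u}} {m : ℕ} {τs : Fin m → Ty.{u}}
    (ht : IsConst lam t (.rel μ m τs)) {ν : Ordinal.{u}} : ∀ {Γ : List Ty.{u}} {c : Fm.{u}}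
    {θ : Ty.{u} → ℕ → Tm.{u}} {σ : ℕ → Tm.{u}}, IsFm lam .ind ν Γ c → CtxWF lam Γ →
      IsEnv lam Γ θ σ → (Truth lam ((c.eliminate t).subst θ σ) ↔ Truth lam (c.subst θ σ))
  | _, _, _, _, .bot _, _, _ => Iff.rfl
  | _, _, _, _, .top _, _, _ => Iff.rfl
  | _, _, _, _, .gt _ _ _, _, _ => Iff.rfl
  | _, _, _, _, .app (f := f) (n := n) (ts := ts) hμ hf hts, hΓ, he => by
    by_cases hft : f = t
    · obtain ⟨b, rfl, -⟩ := ht.exists_cst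
      subst hft
      rw [Fm.eliminate, if_pos rfl]
      have hf' := hf
      cases hf'
      simp only [Fm.subst_inst]
      exact (truth_subst_app hΓ he hf fun j => (he.isClosed hΓ (hts j)).1).symm
    · have : (Fm.app f n ts).eliminate t = .app f n ts := by
        cases f <;> simp only [Fm.eliminate, if_neg hft]
      rw [this]
  | _, _, _, _, .and ha hb, hΓ, he => by
    simp only [Fm.eliminate, Fm.subst, truth_and, truth_subst_eliminate ht ha hΓ he,
      truth_subst_eliminate ht hb hΓ he]
  | _, _, _, _, .or ha hb, hΓ, he => by
    simp only [Fm.eliminate, Fm.subst, truth_or, truth_subst_eliminate ht ha hΓ he,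
      truth_subst_eliminate ht hb hΓ he]
  | _, _, _, _, .neg ha, hΓ, he => by
    simp only [Fm.eliminate, Fm.subst, truth_neg, truth_subst_eliminate ht ha hΓ he]
  | _, _, _, _, .all hτ _ hc, hΓ, he => by
    rw [Fm.eliminate, truth_subst_all, truth_subst_all]
    exact forall₂_congr fun t' ht' => truth_subst_eliminate ht hc (hΓ.cons hτ) (he.cons ht')
  | _, _, _, _, .ex hτ _ hc, hΓ, he => by
    rw [Fm.eliminate, truth_subst_ex, truth_subst_ex]
    exact exists_congr fun t' => and_congr_right fun ht' =>
      truth_subst_eliminate ht hc (hΓ.cons hτ) (he.cons ht')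

theorem hypAt_map {f : Fm.{u} → Fm.{u}} {a : Option Fm.{u}} {θ : Ty.{u} → ℕ → Tm.{u}}
    (h : ∀ c ∈ a, (TrueAt lam θ (f c) ↔ TrueAt lam θ c)) :
    HypAt lam θ (a.map f) ↔ HypAt lam θ a := by
  cases a with
  | none => simp
  | some c => simpa using h c rfl

theorem conAt_map {f : Fm.{u} → Fm.{u}} {a : Option Fm.{u}} {θ : Ty.{u} → ℕ → Tm.{u}}
    (h : ∀ c ∈ a, (TrueAt lam θ (f c) ↔ TrueAt lam θ c)) :
    ConAt lam θ (a.map f) ↔ ConAt lam θ a := by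
  cases a with
  | none => simp
  | some c => simpa using h c rfl

theorem IsClosed.subst_eq {t : Tm.{u}} {τ : Ty.{u}} (h : IsClosed lam t τ)
    (θ : Ty.{u} → ℕ → Tm.{u}) (σ : ℕ → Tm.{u}) : t.subst θ σ = t := by
  conv_rhs => rw [← t.subst_id]
  exact h.1.subst_congr (Γ := []) (fun k hk => (Nat.not_lt_zero k hk).elim)
    fun τ i ho => (h.2 τ i ho).elim

/-- Substituting for `(τ)ᵢ` first and then for the other free variables. -/
theorem subst_replace (θ : Ty.{u} → ℕ → Tm.{u}) (τ : Ty.{u}) (i : ℕ) (t : Tm.{u}) (c : Fm.{u}) :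
    (c.replace τ i t).subst θ Tm.bvar = c.subst (update θ τ i (t.subst θ Tm.bvar)) Tm.bvar := by
  rw [Fm.replace, Fm.subst_subst]
  congr 1
  funext σ j
  simp only [update]
  split_ifs <;> rfl

theorem IndThm.sound {a b : Option Fm.{u}} (h : IndThm lam a b) : Sound lam a b := by
  induction h with
  | num_true hf h =>
    exact ⟨wfOpt_none, wfOpt_some.2 hf, fun _ _ _ => conAt_some.2 (truth_gt.2 h)⟩
  | num_false hf h =>
    exact ⟨wfOpt_some.2 hf, wfOpt_none, fun _ _ ha => (h (truth_gt.1 (hypAt_some.1 ha))).elim⟩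
  | struct_left hs _ ih =>
    refine ⟨wfOpt_some.2 (hs.isFormula.1 (wfOpt_some.1 ih.left)), ih.right, fun θ hθ ha => ?_⟩
    exact ih.valid θ hθ (hypAt_some.2 ((hs.trueAt θ).2 (hypAt_some.1 ha)))
  | struct_right hs _ ih =>
    refine ⟨ih.left, wfOpt_some.2 (hs.isFormula.1 (wfOpt_some.1 ih.right)), fun θ hθ ha => ?_⟩
    exact conAt_some.2 ((hs.trueAt θ).1 (conAt_some.1 (ih.valid θ hθ ha)))
  | weak_right hc _ ih => exact ih.weak_right hc
  | weak_left hc _ ih => exact ih.weak_left hc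
  | and_right _ _ ih₁ ih₂ => exact ih₁.and_right ih₂
  | or_left _ _ ih₁ ih₂ => exact ih₁.or_left ih₂
  | neg_right _ ih => exact ih.neg_right
  | neg_left _ ih => exact ih.neg_left
  | all_right hc ha hb hi _ ih => exact ih.all_right hc ha hb hi
  | ex_left hc ha hb hi _ ih => exact ih.ex_left hc ha hb hi
  | all_left hc ht _ ih => exact ih.all_left hc ht.1
  | ex_right hc ht _ ih => exact ih.ex_right hc ht.1
  | @induction a b τ i hτ ha hb _ ih =>
    refine ⟨ha, hb, fun θ hθ => ?_⟩
    have ht : IsClosed lam (θ τ i) τ := hθ.isClosed CtxWF.nil (.fvar hτ)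
    have h := (ih _ ht.isConst).valid θ hθ
    have key : ∀ c : Fm.{u}, TrueAt lam θ (c.replace τ i (θ τ i)) ↔ TrueAt lam θ c := by
      intro c
      have : update θ τ i (θ τ i) = θ := by
        funext σ j
        simp only [update]
        split_ifs with he
        · rw [he.1, he.2]
        · rfl
      rw [TrueAt, subst_replace, ht.subst_eq, this, TrueAt]
    rwa [hypAt_map fun c _ => key c, conAt_map fun c _ => key c] at h
  | @constants a b ν n τs t ht ha hb _ ih =>
    refine ⟨ha, hb, fun θ hθ => ?_⟩
    have h := ih.valid θ hθ
    have key : ∀ c : Fm.{u}, IsFormula lam .ind c →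
        (TrueAt lam θ (c.eliminate t) ↔ TrueAt lam θ c) :=
      fun c ⟨ν, _, _, hc⟩ => truth_subst_eliminate ht hc CtxWF.nil hθ
    rwa [hypAt_map fun c hc => key c (ha c hc), conAt_map fun c hc => key c (hb c hc)] at h

/-! ### Completeness of the inductive calculus -/

/-- A pair is a theorem if all its instances by closed constants are. -/
theorem IndThm.of_closed_instances {a b : Option Fm.{u}} (ha : WFOpt lam a) (hb : WFOpt lam b)
    (h : ∀ θ, IsEnv lam [] θ Tm.bvar →
      IndThm lam (a.map (Fm.subst θ Tm.bvar)) (b.map (Fm.subst θ Tm.bvar))) : IndThm lam a b := by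
  have main : ∀ (N : Multiset Ordinal.{u}) (M : Multiset (Ty.{u} × ℕ)),
      M.map (fun p => p.1.order) = N → ∀ a b : Option Fm.{u}, WFOpt lam a → WFOpt lam b →
      (∀ c, c ∈ a ∨ c ∈ b → ∀ τ i, c.Occurs τ i → (τ, i) ∈ M) →
      (∀ θ, IsEnv lam [] θ Tm.bvar →
        IndThm lam (a.map (Fm.subst θ Tm.bvar)) (b.map (Fm.subst θ Tm.bvar))) →
      IndThm lam a b := by
    intro N
    induction N using (Multiset.wellFounded_isDershowitzMannaLT (α := Ordinal.{u})).induction with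
    | _ N ih =>
    rintro M rfl a b ha hb hM h
    rcases Multiset.empty_or_exists_mem M with rfl | ⟨⟨τ, i⟩, hp⟩
    · obtain ⟨θ, hθ⟩ := exists_isEnv lam
      have key : ∀ c, c ∈ a ∨ c ∈ b → c.subst θ Tm.bvar = c := by
        intro c hc
        have hwf : IsFormula lam .ind c := hc.elim (ha c) (hb c)
        obtain ⟨ν, _, _, hf⟩ := hwf
        conv_rhs => rw [← c.subst_id]
        exact hf.subst_congr (fun _ _ => rfl)
          fun τ i ho => (Multiset.notMem_zero _ (hM c hc τ i ho)).elim
      have := h θ hθ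
      cases a <;> cases b <;> simpa [key] using this
    · obtain ⟨M, rfl⟩ := Multiset.exists_cons_of_mem hp
      by_cases hτ : τ.WF lam
      · refine .induction (i := i) hτ ha hb fun t ht => ?_
        obtain ⟨F, hF⟩ := (Tm.finite_occurs t).exists_finset
        have hsub : IsSubst lam [] [] (fun σ j => update Tm.fvar τ i t σ j) Tm.bvar := by
          refine ⟨fun σ j hσ => ?_, fun k τ h => by simp at h⟩
          simp only [update]
          split_ifs with he
          · exact he.1 ▸ ht.1
          · exact .fvar hσ
        have hwf : ∀ a : Option Fm.{u}, WFOpt lam a → WFOpt lam (a.map (Fm.replace τ i t)) := by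
          intro a ha c hc
          obtain ⟨d, hd, rfl⟩ := Option.mem_map.1 hc
          obtain ⟨ν, h0, h1, hf⟩ := ha d hd
          exact ⟨ν, h0, h1, hf.subst CtxWF.nil CtxWF.nil hsub⟩
        have hocc : ∀ c d : Fm.{u}, (∀ σ j, c.Occurs σ j → (σ, j) ∈ (τ, i) ::ₘ M) →
            d = c.replace τ i t → ∀ σ j, d.Occurs σ j → (σ, j) ∈ M + F.val := by
          rintro c d hc rfl σ j ho
          rw [Multiset.mem_add]
          rcases c.occurs_subst ho with ⟨σ', j', h1, h2⟩ | ⟨k, hk⟩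
          · split_ifs at h2 with he
            · exact .inr ((hF (σ, j)).2 h2)
            · obtain ⟨rfl, rfl⟩ := h2
              refine .inl ((Multiset.mem_cons.1 (hc _ _ h1)).resolve_left fun e => he ?_)
              exact ⟨congrArg Prod.fst e, congrArg Prod.snd e⟩
          · exact hk.elim
        refine ih ((M + F.val).map fun p => p.1.order) ?_ _ rfl _ _ (hwf a ha) (hwf b hb) ?_ ?_
        · refine ⟨M.map fun p => p.1.order, F.val.map fun p => p.1.order, {τ.order}, by simp, by simp,
            by simp [add_comm, Multiset.singleton_add], ?_⟩
          intro y hy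
          obtain ⟨p, hp, rfl⟩ := Multiset.mem_map.1 hy
          exact ⟨τ.order, by simp, ht.occurs ((hF p).1 hp)⟩
        · rintro d (hd | hd)
          · obtain ⟨c, hc, rfl⟩ := Option.mem_map.1 hd
            exact hocc c _ (hM c (.inl hc)) rfl
          · obtain ⟨c, hc, rfl⟩ := Option.mem_map.1 hd
            exact hocc c _ (hM c (.inr hc)) rfl
        · intro θ hθ
          have h1 := h _ (hθ.update i (hθ.isClosed CtxWF.nil ht.1))
          have h2 : Fm.subst θ Tm.bvar ∘ Fm.replace τ i t =
              Fm.subst (update θ τ i (t.subst θ Tm.bvar)) Tm.bvar :=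
            funext fun c => subst_replace θ τ i t c
          rwa [Option.map_map, Option.map_map, h2]
      · refine ih (M.map fun p => p.1.order) ?_ M rfl a b ha hb ?_ h
        · exact ⟨M.map fun p => p.1.order, 0, {τ.order}, by simp, by simp,
            by simp [add_comm, Multiset.singleton_add], by simp⟩
        · intro c hc σ j ho
          refine (Multiset.mem_cons.1 (hM c hc σ j ho)).resolve_left fun e => hτ ?_
          have hwf : IsFormula lam .ind c := hc.elim (ha c) (hb c)
          obtain ⟨ν, _, _, hf⟩ := hwf
          have := (hf.occurs CtxWF.nil ho).1
          rwa [show σ = τ from congrArg Prod.fst e] at this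
  have hfin : {p : Ty.{u} × ℕ | ∃ c, (c ∈ a ∨ c ∈ b) ∧ c.Occurs p.1 p.2}.Finite := by
    have hopt : ∀ a : Option Fm.{u}, {p : Ty.{u} × ℕ | ∃ c, c ∈ a ∧ c.Occurs p.1 p.2}.Finite := by
      rintro (_ | c)
      · simp
      · simpa using Fm.finite_occurs c
    refine ((hopt a).union (hopt b)).subset ?_
    rintro p ⟨c, hc | hc, ho⟩
    exacts [.inl ⟨c, hc, ho⟩, .inr ⟨c, hc, ho⟩]
  exact main _ hfin.toFinset.val rfl a b ha hb
    (fun c hc τ i ho => (Set.Finite.mem_toFinset hfin).2 ⟨c, hc, ho⟩) h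

theorem subst_inst1_fvar {ν : Ordinal.{u}} {τ : Ty.{u}} {c : Fm.{u}}
    (hc : IsFm lam .ind ν [τ] c) (ho : ∀ σ j, ¬ c.Occurs σ j) (i : ℕ) (θ : Ty.{u} → ℕ → Tm.{u}) :
    (c.inst1 (.fvar τ i)).subst θ Tm.bvar = c.inst1 (θ τ i) := by
  rw [Fm.inst1, Fm.subst_inst, Fm.inst1, Fm.inst_eq]
  exact hc.subst_congr (fun _ _ => rfl) fun τ i h => (ho τ i h).elim

/-- A formula without free variables is provable or refutable, according to its truth. -/
theorem IndThm.of_truth {c : Fm.{u}} (hc : IsFormula lam .ind c) (ho : ∀ τ i, ¬ c.Occurs τ i) :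
    (Truth lam c → IndThm lam none (some c)) ∧ (¬ Truth lam c → IndThm lam (some c) none) := by
  induction hr : rank [] c using WellFoundedLT.induction generalizing c with
  | _ r ih =>
  subst hr
  have hc' := hc
  obtain ⟨ν, h0, h1, hf⟩ := hc'
  have inst_free : ∀ {c : Fm.{u}} {t : Tm.{u}} {τ : Ty.{u}}, (∀ τ i, ¬ c.Occurs τ i) →
      IsClosed lam t τ → ∀ τ i, ¬ (c.inst1 t).Occurs τ i := by
    intro c t τ ho ht σ i h
    rcases c.occurs_subst h with ⟨σ', j', h1, _⟩ | ⟨k, hk⟩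
    · exact ho _ _ h1
    · by_cases hk1 : k < 1
      · simp only [hk1, dite_true] at hk
        exact ht.2 _ _ hk
      · simp [hk1, Tm.Occurs] at hk
  cases hf with
  | bot hK => cases hK
  | top hK => cases hK
  | gt hK hs ht =>
    have key : ∀ {s : Tm.{u}}, IsTm lam .ind [] s .ind → (∀ τ i, ¬ s.Occurs τ i) → ∃ k, s = .num k :=
      fun hs ho => isClosed_ind.1 ⟨hs, ho⟩
    obtain ⟨k, rfl⟩ := key hs fun τ i h => ho τ i (.inl h)
    obtain ⟨l, rfl⟩ := key ht fun τ i h => ho τ i (.inr h)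
    rw [truth_gt]
    exact ⟨.num_true hc, .num_false hc⟩
  | @app _ μ _ f n τs ts hμ hf hts =>
    have hcl : IsClosed lam f (.rel μ n τs) := ⟨hf, fun τ i h => ho τ i (.inl h)⟩
    obtain ⟨b, rfl, hw, hb, hba⟩ := hcl.isConst.exists_cst
    rw [← List.append_nil (ctx τs)] at hb
    have ib := ih _ (rank_inst_lt hcl.isConst hts)
      ⟨μ, hw.pos, hw.lt, (hb.inst CtxWF.nil hw.arg hts).1⟩ ?_ rfl
    · rw [truth_app hcl.isConst hts]
      constructor
      · refine fun h => .constants hcl.isConst (fun _ h => by cases h) (wfOpt_some.2 hc) ?_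
        simpa [Fm.eliminate] using ib.1 h
      · refine fun h => .constants hcl.isConst (wfOpt_some.2 hc) (fun _ h => by cases h) ?_
        simpa [Fm.eliminate] using ib.2 h
    · intro σ i h
      rcases b.occurs_subst h with ⟨σ', j', h1, _⟩ | ⟨k, hk⟩
      · exact ho _ _ (.inl h1)
      · by_cases hkn : k < n
        · simp only [hkn, dite_true] at hk
          exact ho _ _ (.inr ⟨_, hk⟩)
        · simp [hkn, Tm.Occurs] at hk
  | @and _ _ a b ha hb =>
    rw [isFormula_and] at hc
    have ia := ih _ ((le_max_left _ _).trans_lt (lt_add_one _)) hc.1 (fun τ i h => ho τ i (.inl h)) rfl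
    have ib := ih _ ((le_max_right _ _).trans_lt (lt_add_one _)) hc.2 (fun τ i h => ho τ i (.inr h)) rfl
    rw [truth_and]
    refine ⟨fun h => .and_right (c := none) (ia.1 h.1) (ib.1 h.2), fun h => ?_⟩
    by_cases h' : Truth lam a
    · exact .struct_left (.comm _ _) (.weak_left (a := some b) hc.1 (ib.2 fun h2 => h ⟨h', h2⟩))
    · exact .weak_left (a := some a) hc.2 (ia.2 h')
  | @or _ _ a b ha hb =>
    rw [isFormula_or] at hc
    have ia := ih _ ((le_max_left _ _).trans_lt (lt_add_one _)) hc.1 (fun τ i h => ho τ i (.inl h)) rfl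
    have ib := ih _ ((le_max_right _ _).trans_lt (lt_add_one _)) hc.2 (fun τ i h => ho τ i (.inr h)) rfl
    rw [truth_or]
    refine ⟨fun h => ?_, fun h => .or_left (c := none) (ia.2 fun h' => h (.inl h'))
      (ib.2 fun h' => h (.inr h'))⟩
    rcases h with h | h
    · exact .weak_right (b := some a) hc.2 (ia.1 h)
    · exact .struct_right (.comm _ _) (.weak_right (b := some b) hc.1 (ib.1 h))
  | neg ha =>
    have ia := ih _ (lt_add_one _) (isFormula_neg.1 hc) ho rfl
    rw [truth_neg, not_not]
    exact ⟨fun h => .neg_right (a := none) (b := none) (ia.2 h),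
      fun h => .neg_left (a := none) (b := none) (ia.1 h)⟩
  | @all _ _ τ c hτ _ hcf =>
    have hF := (isFormula_all hc).2
    have ic := fun t (ht : IsClosed lam t τ) => ih _
      ((rank_inst1 c ht).trans_lt (lt_add_one _)) (hF.inst1 hτ ht.1) (inst_free ho ht) rfl
    rw [truth_all]
    refine ⟨fun h => ?_, fun h => ?_⟩
    · refine .all_right (a := none) (b := none) (i := 0) hc fresh_none fresh_none (ho _ _) ?_
      refine of_closed_instances wfOpt_none (wfOpt_some.2 (hF.inst1 hτ (.fvar hτ))) fun θ hθ => ?_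
      have ht : IsClosed lam (θ τ 0) τ := hθ.isClosed CtxWF.nil (.fvar hτ)
      simp only [orL, Option.map_none, Option.map_some, subst_inst1_fvar hcf ho]
      exact (ic _ ht).1 (h _ ht)
    · push Not at h
      obtain ⟨t, ht, h⟩ := h
      exact .all_left (a := none) hc ht.isConst ((ic t ht).2 h)
  | @ex _ _ τ c hτ _ hcf =>
    have hF := (isFormula_ex hc).2
    have ic := fun t (ht : IsClosed lam t τ) => ih _
      ((rank_inst1 c ht).trans_lt (lt_add_one _)) (hF.inst1 hτ ht.1) (inst_free ho ht) rfl
    rw [truth_ex]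
    refine ⟨fun ⟨t, ht, h⟩ => .ex_right (b := none) hc ht.isConst ((ic t ht).1 h), fun h => ?_⟩
    push Not at h
    refine .ex_left (a := none) (b := none) (i := 0) hc fresh_none fresh_none (ho _ _) ?_
    refine of_closed_instances (wfOpt_some.2 (hF.inst1 hτ (.fvar hτ))) wfOpt_none fun θ hθ => ?_
    have ht : IsClosed lam (θ τ 0) τ := hθ.isClosed CtxWF.nil (.fvar hτ)
    simp only [andL, Option.map_none, Option.map_some, subst_inst1_fvar hcf ho]
    exact (ic _ ht).2 (h _ ht)

theorem Sound.indThm {a b : Option Fm.{u}} (h : Sound lam a b) : IndThm lam a b := by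
  refine .of_closed_instances h.left h.right fun θ hθ => ?_
  have hv := h.valid θ hθ
  have hcl : ∀ {c : Fm.{u}}, IsFormula lam .ind c →
      (TrueAt lam θ c → IndThm lam none (some (c.subst θ Tm.bvar))) ∧
        (¬ TrueAt lam θ c → IndThm lam (some (c.subst θ Tm.bvar)) none) ∧
        IsFormula lam .ind (c.subst θ Tm.bvar) := by
    rintro c ⟨ν, h0, h1, hc⟩
    have hf : IsFormula lam .ind (c.subst θ Tm.bvar) :=
      ⟨ν, h0, h1, hc.subst CtxWF.nil CtxWF.nil hθ.toIsSubst⟩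
    have := IndThm.of_truth hf (hθ.not_occurs c)
    exact ⟨this.1, this.2, hf⟩
  have ha := h.left
  have hb := h.right
  rcases a with _ | a <;> rcases b with _ | b <;>
    simp only [hypAt_none, hypAt_some, conAt_none, conAt_some, wfOpt_some] at hv ha hb <;>
    simp only [Option.map_none, Option.map_some]
  · exact (hv trivial).elim
  · exact (hcl hb).1 (hv trivial)
  · exact (hcl ha).2.1 hv
  · by_cases hta : TrueAt lam θ a
    · exact .weak_left (a := none) (hcl ha).2.2 ((hcl hb).1 (hv hta))
    · exact .weak_right (b := none) (hcl hb).2.2 ((hcl ha).2.1 hta)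

/-! ### Soundness of the deductive calculi -/

/-- The inductive formula obtained by putting `1 > 1` for the sign `0` and `1 + 1 > 1` for `1`. -/
def Fm.star : Fm.{u} → Fm.{u}
  | .bot => .gt (.num 0) (.num 0)
  | .top => .gt (.num 1) (.num 0)
  | .gt s t => .gt s t
  | .app f n ts => .app f n ts
  | .and a b => .and a.star b.star
  | .or a b => .or a.star b.star
  | .neg a => .neg a.star
  | .all τ c => .all τ c.star
  | .ex τ c => .ex τ c.star

theorem Fm.star_subst : ∀ (c : Fm.{u}) (θ : Ty.{u} → ℕ → Tm.{u}) (σ : ℕ → Tm.{u}),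
    (c.subst θ σ).star = c.star.subst θ σ
  | .bot, _, _ => rfl
  | .top, _, _ => rfl
  | .gt _ _, _, _ => rfl
  | .app _ _ _, _, _ => rfl
  | .and a b, θ, σ => by simp only [Fm.subst, Fm.star, Fm.star_subst a, Fm.star_subst b]
  | .or a b, θ, σ => by simp only [Fm.subst, Fm.star, Fm.star_subst a, Fm.star_subst b]
  | .neg a, θ, σ => by simp only [Fm.subst, Fm.star, Fm.star_subst a]
  | .all τ c, θ, σ => by simp only [Fm.subst, Fm.star, Fm.star_subst c]
  | .ex τ c, θ, σ => by simp only [Fm.subst, Fm.star, Fm.star_subst c]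

theorem Fm.star_inst1 (c : Fm.{u}) (t : Tm.{u}) : (c.inst1 t).star = c.star.inst1 t :=
  c.star_subst _ _

theorem Fm.star_occurs {τ : Ty.{u}} {i : ℕ} : ∀ c : Fm.{u}, c.star.Occurs τ i → c.Occurs τ i
  | .bot, h => h.elim id id
  | .top, h => h.elim id id
  | .gt _ _, h => h
  | .app _ _ _, h => h
  | .and a b, h => h.imp (Fm.star_occurs a) (Fm.star_occurs b)
  | .or a b, h => h.imp (Fm.star_occurs a) (Fm.star_occurs b)
  | .neg a, h => Fm.star_occurs a h
  | .all _ c, h => Fm.star_occurs c h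
  | .ex _ c, h => Fm.star_occurs c h

theorem star_alls {c : Fm.{u}} : ∀ {n : ℕ} {τs : Fin n → Ty.{u}},
    (alls n τs c).star = alls n τs c.star
  | 0, _ => rfl
  | n + 1, τs => by simp only [alls, Fm.star, star_alls (n := n)]

theorem star_comprehension (ν : Ordinal.{u}) (n : ℕ) (τs : Fin n → Ty.{u}) (c : Fm.{u}) :
    (comprehension ν n τs c).star = comprehension ν n τs c.star := by
  simp only [comprehension, Fm.star, star_alls, Fm.iff, Fm.imp, appVars]

theorem star_coext (n : ℕ) (τs : Fin n → Ty.{u}) (p q : Tm.{u}) :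
    (coext n τs p q).star = coext n τs p q := by
  simp only [coext, star_alls, Fm.iff, Fm.imp, appVars, Fm.star]

theorem IsTm.toInd {K : Calc} (hK : K ≠ .ind) {Γ : List Ty.{u}} {t : Tm.{u}} {τ : Ty.{u}}
    (h : IsTm lam K Γ t τ) : IsTm lam .ind Γ t τ := by
  cases h with
  | fvar hτ => exact .fvar hτ
  | bvar h => exact .bvar h
  | num h => exact absurd h hK
  | cst h => exact absurd h hK

theorem IsFm.star {K : Calc} (hK : K ≠ .ind) {ν : Ordinal.{u}} : ∀ {Γ : List Ty.{u}} {c : Fm.{u}},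
    IsFm lam K ν Γ c → IsFm lam .ind ν Γ c.star
  | _, _, .bot _ => .gt rfl (.num rfl) (.num rfl)
  | _, _, .top _ => .gt rfl (.num rfl) (.num rfl)
  | _, _, .gt h _ _ => absurd h hK
  | _, _, .app hμ hf hts => .app hμ (hf.toInd hK) fun j => (hts j).toInd hK
  | _, _, .and ha hb => .and (ha.star hK) (hb.star hK)
  | _, _, .or ha hb => .or (ha.star hK) (hb.star hK)
  | _, _, .neg ha => .neg (ha.star hK)
  | _, _, .all hτ h hc => .all hτ h (hc.star hK)
  | _, _, .ex hτ h hc => .ex hτ h (hc.star hK)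

theorem IsFormulaIn.star {K : Calc} (hK : K ≠ .ind) {Γ : List Ty.{u}} {c : Fm.{u}}
    (h : IsFormulaIn lam K Γ c) : IsFormulaIn lam .ind Γ c.star := by
  obtain ⟨ν, h0, h1, h⟩ := h
  exact ⟨ν, h0, h1, h.star hK⟩

theorem isFormula_star {K : Calc} (hK : K ≠ .ind) {c : Fm.{u}} (h : IsFormula lam K c) :
    IsFormula lam .ind c.star := IsFormulaIn.star hK h

theorem IsFm.star_eq {ν : Ordinal.{u}} : ∀ {Γ : List Ty.{u}} {c : Fm.{u}},
    IsFm lam .proper ν Γ c → c.star = c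
  | _, _, .bot h => by cases h
  | _, _, .top h => by cases h
  | _, _, .gt h _ _ => by cases h
  | _, _, .app _ _ _ => rfl
  | _, _, .and ha hb => by rw [Fm.star, ha.star_eq, hb.star_eq]
  | _, _, .or ha hb => by rw [Fm.star, ha.star_eq, hb.star_eq]
  | _, _, .neg ha => by rw [Fm.star, ha.star_eq]
  | _, _, .all _ _ hc => by rw [Fm.star, hc.star_eq]
  | _, _, .ex _ _ hc => by rw [Fm.star, hc.star_eq]

theorem IsFormulaIn.proper_ind {Γ : List Ty.{u}} {c : Fm.{u}}
    (h : IsFormulaIn lam .proper Γ c) : IsFormulaIn lam .ind Γ c := by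
  obtain ⟨ν, h0, h1, h⟩ := h
  have h' := h.star (K := .proper) nofun
  rw [h.star_eq] at h'
  exact ⟨ν, h0, h1, h'⟩

theorem IsFormula.proper_ind {c : Fm.{u}} (h : IsFormula lam .proper c) : IsFormula lam .ind c :=
  IsFormulaIn.proper_ind h

theorem ProperThm.sound {a b : Option Fm.{u}} (h : ProperThm lam a b) : Sound lam a b := by
  induction h with
  | refl hc => exact .refl hc.proper_ind
  | comp hc h =>
    refine .comp ?_ h.proper_ind
    have h' := hc.star (K := .proper) nofun
    rwa [hc.star_eq] at h'
  | ext hτ hc => exact .ext hτ hc.proper_ind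
  | inf h => exact .inf h.proper_ind
  | cut _ _ ih₁ ih₂ => exact ih₁.cut ih₂
  | and_left₁ hc _ ih => exact ih.weak_left hc.proper_ind
  | and_left₂ hc _ ih => exact ih.weak_left' hc.proper_ind
  | or_right₁ hc _ ih => exact ih.weak_right hc.proper_ind
  | or_right₂ hc _ ih => exact ih.weak_right' hc.proper_ind
  | and_right _ _ ih₁ ih₂ => exact ih₁.and_right (b := none) ih₂
  | or_left _ _ ih₁ ih₂ => exact ih₁.or_left (a := none) ih₂
  | neg_right _ ih => exact ih.neg_right
  | neg_left _ ih => exact ih.neg_left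
  | all_spec _ ih => exact ih.all_spec
  | ex_spec _ ih => exact ih.ex_spec
  | all_right hc ha hi _ ih => exact Sound.all_right (b := none) hc.proper_ind ha fresh_none hi ih
  | ex_left hc hb hi _ ih => exact Sound.ex_left (a := none) hc.proper_ind fresh_none hb hi ih

theorem DedThm.sound {a b : Fm.{u}} (h : DedThm lam a b) :
    Sound lam (some a.star) (some b.star) := by
  have formula_top : ∀ {c : Fm.{u}} (d : Fm.{u}), IsFormula lam .ded c →
      (d = .top ∨ d = .bot) → IsFormula lam .ind d.star := by
    rintro c d ⟨ν, h0, h1, -⟩ (rfl | rfl)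
    exacts [⟨ν, h0, h1, .gt rfl (.num rfl) (.num rfl)⟩, ⟨ν, h0, h1, .gt rfl (.num rfl) (.num rfl)⟩]
  have star {c : Fm.{u}} (hc : IsFormula lam .ded c) := isFormula_star (K := .ded) nofun hc
  induction h with
  | refl hc => exact .refl (star hc)
  | bot_le hc =>
    exact ⟨wfOpt_some.2 (formula_top _ hc (.inr rfl)), wfOpt_some.2 (star hc),
      fun _ _ h => (lt_irrefl 0 (truth_gt.1 (hypAt_some.1 h))).elim⟩
  | le_top hc =>
    exact ⟨wfOpt_some.2 (star hc), wfOpt_some.2 (formula_top _ hc (.inl rfl)),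
      fun _ _ _ => conAt_some.2 (truth_gt.2 Nat.one_pos)⟩
  | comp hc h =>
    have h' := star h
    rw [star_comprehension] at h' ⊢
    exact (Sound.comp (hc.star (K := .ded) nofun) h').weak_left (formula_top _ h (.inl rfl))
  | ext hτ hc =>
    rw [star_coext, Fm.imp, Fm.star, Fm.star, Fm.star_inst1, Fm.star_inst1]
    exact .ext hτ (hc.star (K := .ded) nofun)
  | inf h => exact (Sound.inf (star h)).weak_left (formula_top _ h (.inl rfl))
  | cut _ _ ih₁ ih₂ => exact ih₁.cut ih₂
  | and_left₁ hc _ ih => exact ih.weak_left (star hc)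
  | and_left₂ hc _ ih => exact ih.weak_left' (star hc)
  | or_right₁ hc _ ih => exact ih.weak_right (star hc)
  | or_right₂ hc _ ih => exact ih.weak_right' (star hc)
  | and_right _ _ ih₁ ih₂ => exact ih₁.and_right (b := none) ih₂
  | or_left _ _ ih₁ ih₂ => exact ih₁.or_left (a := none) ih₂
  | @neg_right a b c _ ih => exact ih.neg_right (a := some a.star) (b := some b.star)
  | @neg_left a b c _ ih => exact ih.neg_left (a := some a.star) (b := some b.star)
  | all_spec _ ih =>
    rw [Fm.star_inst1]
    exact ih.all_spec
  | ex_spec _ ih =>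
    rw [Fm.star_inst1]
    exact ih.ex_spec
  | all_right hc ha hi _ ih =>
    rw [Fm.star_inst1] at ih
    exact Sound.all_right (b := none) (star hc) (fresh_some fun h => ha (Fm.star_occurs _ h))
      fresh_none (fun h => hi (Fm.star_occurs _ h)) ih
  | ex_left hc hb hi _ ih =>
    rw [Fm.star_inst1] at ih
    exact Sound.ex_left (a := none) (star hc) fresh_none
      (fresh_some fun h => hb (Fm.star_occurs _ h)) (fun h => hi (Fm.star_occurs _ h)) ih

end Ramified

/-- Every theorem of the proper deductive calculus is a theorem of the inductive calculus; the cut rule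
is admissible in the inductive calculus; the empty sequent is a theorem of neither of the two; and
`1 ⟹ 0` is not a theorem of the deductive calculus. -/
theorem mainTheorem1 (lam : Ordinal.{u}) :
    (∀ a b : Option Ramified.Fm.{u}, Ramified.ProperThm lam a b → Ramified.IndThm lam a b) ∧
    (∀ (a b : Option Ramified.Fm.{u}) (c : Ramified.Fm.{u}),
      Ramified.IndThm lam a (some c) → Ramified.IndThm lam (some c) b → Ramified.IndThm lam a b) ∧
    ¬ Ramified.IndThm lam none none ∧
    ¬ Ramified.ProperThm lam none none ∧
    ¬ Ramified.DedThm lam .top .bot := by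
  refine ⟨fun a b h => h.sound.indThm, fun a b c h₁ h₂ => (h₁.sound.cut h₂.sound).indThm,
    fun h => Ramified.Sound.not_none_none h.sound, fun h => Ramified.Sound.not_none_none h.sound,
    fun h => ?_⟩
  obtain ⟨θ, hθ⟩ := Ramified.exists_isEnv lam
  have := h.sound.valid θ hθ (Ramified.hypAt_some.2 (Ramified.truth_gt.2 Nat.one_pos))
  exact lt_irrefl 0 (Ramified.truth_gt.1 (Ramified.conAt_some.1 this))
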